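/- Fix an integer $d\ge 2$. Let $\mathbf n=\mathbf e_1+\dots+\mathbf e_{d+1}\in\mathbb Z^{d+1}$, let $X^d=\mathbb Z^{d+1}/\mathbb Z\mathbf n$, made into a graph by joining $[\mathbf x]$ to $[\mathbf x\pm\mathbf e_i]$ for $1\le i\le d+1$, with graph distance $\operatorname{dist}$. Let $H=\mathbf n^\perp\subset\mathbb R^{d+1}$, let $P$ be the orthogonal projection onto $H$, identify $[\mathbf x]\in X^d$ with $P\mathbf x\in H$, and put $\mathbf g_i=P\mathbf e_i$. Let $\Omega$ be the set of height functions, that is, of functions $f:X^d\to\mathbb Z$ with $f(0)\in(d+1)\mathbb Z$ and $f(x+\mathbf g_i)-f(x)\in\{1,-d\}$ for all $x\in X^d$ and all $i$. For finite $R\subset X^d$ and $f\in\Omega$ let $\Omega(R,f)$ be the finite set of those $g\in\Omega$ that agree with $f$ outside $R$. Let $\mathcal S=\{s\in H^*:\max_i s(\mathbf g_i)\le 1\}$, and for $s\in\mathcal S$ let $\lfloor s\rfloor$ be the largest height function $g$ with $g\le s|_{X^d}$. Let $\Pi_n=\{a_1\mathbf g_1+\dots+a_d\mathbf g_d: a_i\in\mathbb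 Z,\ -n\le a_i<n\}$. The surface tension at $s\in\mathcal S$ is $$\sigma(s)=\lim_{n\to\infty}-\frac1{|\Pi_n|}\log|\Omega(\Pi_n,\lfloor s\rfloor)|.$$ Let $\mathcal F^\nabla$ be the $\sigma$-algebra on $\Omega$ generated by the differences $f(x)-f(y)$, $x,y\in X^d$. For a probability measure $\mu$ on $(\Omega,\mathcal F^\nabla)$ and a finite set $R\subset X^d$, write $D_Rf=(f(y)-f(x))_{x,y\in R}$, a map on $\Omega$ with finite image, and $$\mathcal H_R(\mu)=\sum_{z\in\operatorname{Im}D_R}\mu(D_Rf=z)\log\mu(D_Rf=z)$$ (with $0\log 0=0$). The specific entropy of $\mu$ is $\mathcal H(\mu)=\lim_{n\to\infty}|\Pi_n|^{-1}\mathcal H_{\Pi_n}(\mu)$ if this limit exists, and the corresponding limit inferior otherwise. **Theorem.** Let $s\in\mathcal S$, and let $\mu$ be a probability measure on $(\Omega,\mathcal F^\nabla)$ that is * shift-invariant: $\mu(\tilde\theta_xA)=\mu(A)$ for all $x\in X^d$ and $A\in\mathcal F^\nabla$, where $\tilde\theta_xf=f(\cdot+x)-f(x)+f(0)$; * a gradient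 Gibbs measure: $\mu(A)=\int\frac{|\Omega(R,f)\cap A|}{|\Omega(R,f)|}\,d\mu(f)$ for every finite $R\subset X^d$ and every $A\in\mathcal F^\nabla$; * of slope $s$: $\int(f(x)-f(0))\,d\mu=s(x)$ for all $x\in X^d$; * concentrated: for all $x,y\in X^d$ and $n=\operatorname{dist}(x,y)$, we have $\operatorname{Var}_\mu(f(y)-f(x))\le(d+1)^2n$, and, if $n>0$, also $\mu(f(y)-f(x)-s(y-x)\ge(d+1)a)\le e^{-a^2/(2n)}$ for all $a\ge0$ and $\mu(f(y)-f(x)-s(y-x)\le(d+1)a)\le e^{-a^2/(2n)}$ for all $a\le0$. Then the limit defining $\sigma(s)$ exists, and $\mathcal H(\mu)=\sigma(s)$. -/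

import Mathlib

open MeasureTheory Filter Topology
open scoped ENNReal

noncomputable section

namespace Stepped

/-- The vertex set `X^d = ℤ^{d+1} / ℤ𝐧` of the simplicial lattice, `𝐧 = 𝐞₁ + ⋯ + 𝐞_{d+1}`. -/
abbrev Vertex (d : ℕ) : Type :=
  (Fin (d + 1) → ℤ) ⧸ AddSubgroup.zmultiples (1 : Fin (d + 1) → ℤ)

/-- The class `[𝐱]` of `𝐱 ∈ ℤ^{d+1}`. -/
abbrev cls {d : ℕ} (x : Fin (d + 1) → ℤ) : Vertex d := QuotientAddGroup.mk x

/-- The generator `[𝐞ᵢ]` of `X^d`. -/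
def gen {d : ℕ} (i : Fin (d + 1)) : Vertex d := cls (Pi.single i 1)

/-- The simplicial lattice `(X^d, E^d)`: the neighbours of `x` are the vertices `x ± [𝐞ᵢ]`. -/
def latticeGraph (d : ℕ) : SimpleGraph (Vertex d) :=
  SimpleGraph.fromRel fun x y => ∃ i, y = x + gen i

/-- The hyperplane `H ⊆ ℝ^{d+1}`, the orthogonal complement of `𝐧`. -/
def Hyperplane (d : ℕ) : Submodule ℝ (Fin (d + 1) → ℝ) :=
  LinearMap.ker (∑ i : Fin (d + 1), LinearMap.proj (R := ℝ) (φ := fun _ => ℝ) i)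

lemma mem_hyperplane {d : ℕ} (v : Fin (d + 1) → ℝ) :
    v ∈ Hyperplane d ↔ ∑ i, v i = 0 := by
  simp [Hyperplane]

/-- The orthogonal projection `P 𝐱 = 𝐱 - ((𝐱, 𝐧) / (d+1)) 𝐧` onto `H`, on integer points. -/
def projInt (d : ℕ) : (Fin (d + 1) → ℤ) →+ Hyperplane d where
  toFun x := ⟨fun i => (x i : ℝ) - (∑ j, (x j : ℝ)) / (d + 1), by
    have h : (d : ℝ) + 1 ≠ 0 := by positivity
    rw [mem_hyperplane]
    simp only [Finset.sum_sub_distrib, Finset.sum_const, Finset.card_univ, Fintype.card_fin,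
      nsmul_eq_mul, Nat.cast_add, Nat.cast_one]
    field_simp
    ring⟩
  map_zero' := by ext i; simp
  map_add' x y := by
    ext i
    simp only [Pi.add_apply, Int.cast_add, Finset.sum_add_distrib, Submodule.coe_add]
    ring

/-- The identification of `X^d` with a subset of `H`, `[𝐱] ↦ P 𝐱`. -/
def embed (d : ℕ) : Vertex d →+ Hyperplane d :=
  QuotientAddGroup.lift _ (projInt d) (by
    refine AddSubgroup.zmultiples_le_of_mem ?_
    rw [AddMonoidHom.mem_ker]
    have h : (d : ℝ) + 1 ≠ 0 := by positivity
    ext i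
    simp [projInt, h])

/-- Slopes: linear forms on `H`. -/
abbrev Slope (d : ℕ) : Type := Module.Dual ℝ (Hyperplane d)

/-- The set `𝒮` of Lipschitz slopes, `maxᵢ s(𝐠ᵢ) ≤ 1` where `𝐠ᵢ = P 𝐞ᵢ`. -/
def lipSlopes (d : ℕ) : Set (Slope d) := {s | ∀ i, s (embed d (gen i)) ≤ 1}

/-- The set `Ω` of height functions. -/
@[ext] structure HeightFunction (d : ℕ) where
  toFun : Vertex d → ℤ
  dvd_zero : ((d : ℤ) + 1) ∣ toFun 0
  grad : ∀ x i, toFun (x + gen i) - toFun x = 1 ∨ toFun (x + gen i) - toFun x = -(d : ℤ)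

instance (d : ℕ) : CoeFun (HeightFunction d) (fun _ => Vertex d → ℤ) := ⟨HeightFunction.toFun⟩

/-- The shift `θ̃ₓ f = f(· + x) - f(x) + f(0)`. -/
def shift {d : ℕ} (x : Vertex d) (f : HeightFunction d) : HeightFunction d where
  toFun y := f (y + x) - f x + f 0
  dvd_zero := by simpa using f.dvd_zero
  grad y i := by
    have h := f.grad (y + x) i
    rw [show y + gen i + x = y + x + gen i by abel]
    omega

/-- `Ω(R, f)`: the height functions that agree with `f` outside `R`. -/
def fixedBdry {d : ℕ} (R : Set (Vertex d)) (f : HeightFunction d) : Set (HeightFunction d) :=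
  {g | ∀ x ∉ R, g x = f x}

/-! ### The height function `⌊F⌋` -/

/-- The residue `(𝐱, 𝐧) mod d + 1` of a vertex `[𝐱]`. -/
def residue (d : ℕ) : Vertex d →+ ZMod (d + 1) :=
  QuotientAddGroup.lift _
    (AddMonoidHom.mk' (fun x : Fin (d + 1) → ℤ => ((∑ i, x i : ℤ) : ZMod (d + 1)))
      (fun x y => by simp [Finset.sum_add_distrib]))
    (by
      refine AddSubgroup.zmultiples_le_of_mem ?_
      rw [AddMonoidHom.mem_ker]
      simp)

lemma residue_gen {d : ℕ} (i : Fin (d + 1)) : residue d (gen i) = 1 := by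
  change ((∑ j, (Pi.single i 1 : Fin (d + 1) → ℤ) j : ℤ) : ZMod (d + 1)) = 1
  simp

lemma sum_gen (d : ℕ) : ∑ i : Fin (d + 1), (gen i : Vertex d) = 0 := by
  have h : ∑ i : Fin (d + 1), (gen i : Vertex d)
      = QuotientAddGroup.mk' (AddSubgroup.zmultiples (1 : Fin (d + 1) → ℤ))
          (∑ i, Pi.single i (1 : ℤ)) := by
    rw [map_sum]; rfl
  rw [h, QuotientAddGroup.mk'_apply, QuotientAddGroup.eq_zero_iff]
  have : (∑ i : Fin (d + 1), Pi.single i (1 : ℤ)) = (1 : Fin (d + 1) → ℤ) :=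
    Finset.univ_sum_single (1 : Fin (d + 1) → ℤ)
  rw [this]
  exact AddSubgroup.mem_zmultiples _

/-- The Lipschitz condition `F(x + [𝐞ᵢ]) ≤ F(x) + 1` for functions on `X^d`. -/
def IsLip {d : ℕ} (F : Vertex d → ℝ) : Prop := ∀ x i, F (x + gen i) ≤ F x + 1

lemma IsLip.sum_le {d : ℕ} {F : Vertex d → ℝ} (hF : IsLip F) (x : Vertex d)
    (A : Finset (Fin (d + 1))) : F (x + ∑ j ∈ A, gen j) ≤ F x + A.card := by
  classical
  induction A using Finset.induction_on with
  | empty => simp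
  | insert a A ha ih =>
    rw [Finset.sum_insert ha, Finset.card_insert_of_notMem ha,
      show x + (gen a + ∑ j ∈ A, gen j) = x + ∑ j ∈ A, gen j + gen a by abel]
    have := hF (x + ∑ j ∈ A, gen j) a
    push_cast
    linarith

lemma IsLip.le_add {d : ℕ} {F : Vertex d → ℝ} (hF : IsLip F) (x : Vertex d) (i : Fin (d + 1)) :
    F x ≤ F (x + gen i) + d := by
  classical
  have h := hF.sum_le (x + gen i) (Finset.univ.erase i)
  rw [add_assoc, Finset.add_sum_erase _ _ (Finset.mem_univ i), sum_gen, add_zero] at h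
  simpa using h

/-- The largest integer `k ≤ F(x)` that has the residue of `x` modulo `d + 1`. -/
def floorVal {d : ℕ} (F : Vertex d → ℝ) (x : Vertex d) : ℤ :=
  ⌊F x⌋ - ((((⌊F x⌋ : ℤ) : ZMod (d + 1)) - residue d x).val : ℤ)

lemma floorVal_cast {d : ℕ} (F : Vertex d → ℝ) (x : Vertex d) :
    ((floorVal F x : ℤ) : ZMod (d + 1)) = residue d x := by
  simp [floorVal]

lemma floorVal_le {d : ℕ} (F : Vertex d → ℝ) (x : Vertex d) : (floorVal F x : ℝ) ≤ F x := by
  refine le_trans ?_ (Int.floor_le (F x))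
  have : floorVal F x ≤ ⌊F x⌋ := by unfold floorVal; omega
  exact_mod_cast this

lemma lt_floorVal {d : ℕ} (F : Vertex d → ℝ) (x : Vertex d) :
    F x < floorVal F x + (d + 1) := by
  have h1 : ⌊F x⌋ + 1 ≤ floorVal F x + (d + 1) := by
    have := ZMod.val_lt (((⌊F x⌋ : ℤ) : ZMod (d + 1)) - residue d x)
    unfold floorVal
    omega
  have h2 := Int.lt_floor_add_one (F x)
  have h3 : ((⌊F x⌋ : ℝ) + 1) ≤ floorVal F x + (d + 1) := by exact_mod_cast h1
  linarith

/-- The height function `⌊F⌋` of a Lipschitz function `F`: see `lipFloor_isGreatest`. -/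
def lipFloor {d : ℕ} (F : Vertex d → ℝ) (hF : IsLip F) : HeightFunction d where
  toFun := floorVal F
  dvd_zero := by
    have h := floorVal_cast F 0
    rw [map_zero, ZMod.intCast_zmod_eq_zero_iff_dvd] at h
    exact_mod_cast h
  grad x i := by
    have h : ((floorVal F (x + gen i) - (floorVal F x + 1) : ℤ) : ZMod (d + 1)) = 0 := by
      push_cast
      rw [floorVal_cast, floorVal_cast, map_add, residue_gen, sub_self]
    rw [ZMod.intCast_zmod_eq_zero_iff_dvd] at h
    obtain ⟨t, ht⟩ := h
    push_cast at ht
    have a1 := floorVal_le F (x + gen i)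
    have a2 := lt_floorVal F (x + gen i)
    have a3 := floorVal_le F x
    have a4 := lt_floorVal F x
    have a5 := hF x i
    have a6 := hF.le_add x i
    have b1 : floorVal F (x + gen i) - (floorVal F x + 1) < (d : ℤ) + 1 := by
      have : (floorVal F (x + gen i) : ℝ) - (floorVal F x + 1) < (d : ℝ) + 1 := by linarith
      exact_mod_cast this
    have b2 : -2 * ((d : ℤ) + 1) < floorVal F (x + gen i) - (floorVal F x + 1) := by
      have : -2 * ((d : ℝ) + 1) < (floorVal F (x + gen i) : ℝ) - (floorVal F x + 1) := by linarith
      exact_mod_cast this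
    rw [ht] at b1 b2
    have c1 : t < 1 := by nlinarith
    have c2 : -2 < t := by nlinarith
    obtain rfl | rfl : t = 0 ∨ t = -1 := by omega
    · left; linarith
    · right; linarith

lemma HeightFunction.cast_eq_residue {d : ℕ} (g : HeightFunction d) (x : Vertex d) :
    ((g x : ℤ) : ZMod (d + 1)) = residue d x := by
  have hd : ((d : ZMod (d + 1)) + 1) = 0 := by exact_mod_cast ZMod.natCast_self (d + 1)
  have step : ∀ y i, ((g (y + gen i) : ℤ) : ZMod (d + 1)) = (g y : ℤ) + 1 := by
    intro y i
    rcases g.grad y i with h | h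
    · rw [sub_eq_iff_eq_add.mp h]; push_cast; ring
    · rw [sub_eq_iff_eq_add.mp h]; push_cast; linear_combination -hd
  have stepz : ∀ (k : ℤ) y i, ((g (y + k • gen i) : ℤ) : ZMod (d + 1)) = (g y : ℤ) + k := by
    intro k y i
    induction k using Int.induction_on with
    | zero => simp
    | succ n ih =>
      have := step (y + (n : ℤ) • gen i) i
      rw [add_one_zsmul, ← add_assoc, this, ih]; push_cast; ring
    | pred n ih =>
      have := step (y + (-(n : ℤ) - 1) • gen i) i
      rw [add_assoc, ← add_one_zsmul, sub_add_cancel, ih] at this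
      push_cast at this ⊢
      linear_combination -this
  have key : ∀ (v : Fin (d + 1) → ℤ) (A : Finset (Fin (d + 1))),
      ((g (∑ i ∈ A, v i • gen i) : ℤ) : ZMod (d + 1)) = residue d (∑ i ∈ A, v i • gen i) := by
    classical
    intro v A
    induction A using Finset.induction_on with
    | empty =>
      rw [Finset.sum_empty, map_zero, ZMod.intCast_zmod_eq_zero_iff_dvd]
      exact_mod_cast g.dvd_zero
    | insert a A ha ih =>
      rw [Finset.sum_insert ha, add_comm (v a • gen a), stepz, ih, map_add, map_zsmul, residue_gen]
      simp
  induction x using QuotientAddGroup.induction_on with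
  | H v =>
    have hv : (QuotientAddGroup.mk v : Vertex d) = ∑ i, v i • gen i := by
      have : v = ∑ i, v i • (Pi.single i (1 : ℤ) : Fin (d + 1) → ℤ) := by
        ext j; simp [Finset.sum_apply, Pi.single_apply]
      conv_lhs => rw [this]
      rw [← QuotientAddGroup.mk'_apply, map_sum]
      rfl
    rw [hv]
    exact key v _

/-- `⌊F⌋` is the largest height function below `F`. -/
lemma lipFloor_isGreatest {d : ℕ} (F : Vertex d → ℝ) (hF : IsLip F) :
    (∀ x, (lipFloor F hF x : ℝ) ≤ F x) ∧
      ∀ g : HeightFunction d, (∀ x, (g x : ℝ) ≤ F x) → ∀ x, g x ≤ lipFloor F hF x := by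
  refine ⟨floorVal_le F, fun g hg x => ?_⟩
  change g x ≤ floorVal F x
  have h : ((g x - floorVal F x : ℤ) : ZMod (d + 1)) = 0 := by
    push_cast
    rw [g.cast_eq_residue, floorVal_cast, sub_self]
  rw [ZMod.intCast_zmod_eq_zero_iff_dvd] at h
  obtain ⟨t, ht⟩ := h
  push_cast at ht
  have h1 : g x < floorVal F x + ((d : ℤ) + 1) := by
    have : (g x : ℝ) < floorVal F x + ((d : ℝ) + 1) := (hg x).trans_lt (lt_floorVal F x)
    exact_mod_cast this
  have : t < 1 := by nlinarith
  nlinarith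

lemma isLip_of_mem {d : ℕ} {s : Slope d} (hs : s ∈ lipSlopes d) :
    IsLip fun x => s (embed d x) := by
  intro x i
  have := hs i
  simp only [map_add]
  linarith

/-! ### The surface tension -/

open Classical in
/-- The centred box `Πₙ = {a₁𝐠₁ + ⋯ + a_d𝐠_d : -n ≤ a₁, …, a_d < n}`. -/
def box (d n : ℕ) : Finset (Vertex d) :=
  (Fintype.piFinset fun _ : Fin d => Finset.Ico (-(n : ℤ)) n).image
    fun a => ∑ i, a i • gen i.castSucc

/-- `-|Πₙ|⁻¹ log |Ω(Πₙ, ⌊s⌋)|`. -/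
def tensionSeq {d : ℕ} (s : Slope d) (hs : s ∈ lipSlopes d) (n : ℕ) : ℝ :=
  -(1 / ((box d n).card : ℝ)) *
    Real.log ((fixedBdry (box d n : Set (Vertex d))
      (lipFloor (fun x => s (embed d x)) (isLip_of_mem hs))).ncard : ℝ)

/-- The surface tension `σ(s) = lim -|Πₙ|⁻¹ log |Ω(Πₙ, ⌊s⌋)|`. -/
def surfaceTension {d : ℕ} (s : Slope d) (hs : s ∈ lipSlopes d) : ℝ :=
  limUnder atTop (tensionSeq s hs)

/-! ### Gradient Gibbs measures -/

/-- The σ-algebra `ℱ^∇` generated by the differences `f(x) - f(y)`. Measures on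
`HeightFunction d` are therefore gradient measures. -/
instance gradSigma (d : ℕ) : MeasurableSpace (HeightFunction d) :=
  ⨆ (x : Vertex d) (y : Vertex d),
    MeasurableSpace.comap (fun f : HeightFunction d => f x - f y) ⊤

/-- `γ_R(A, f)`: the probability of `A` for a uniformly random element of `Ω(R, f)`. -/
def gibbsKernel {d : ℕ} (R : Finset (Vertex d)) (A : Set (HeightFunction d))
    (f : HeightFunction d) : ℝ≥0∞ :=
  ((fixedBdry (R : Set (Vertex d)) f ∩ A).ncard : ℝ≥0∞) /
    ((fixedBdry (R : Set (Vertex d)) f).ncard : ℝ≥0∞)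

/-- The DLR equations `μ = μ γ_R` on `ℱ^∇` for all finite `R`. -/
def IsGradientGibbs {d : ℕ} (μ : Measure (HeightFunction d)) : Prop :=
  ∀ (R : Finset (Vertex d)) (A : Set (HeightFunction d)), MeasurableSet A →
    μ A = ∫⁻ f, gibbsKernel R A f ∂μ

def IsShiftInvariant {d : ℕ} (μ : Measure (HeightFunction d)) : Prop :=
  ∀ (x : Vertex d) (A : Set (HeightFunction d)), MeasurableSet A → μ (shift x '' A) = μ A

/-- `μ` has slope `s`: `s(x) = μ(f(x) - f(0))` for all `x`. -/
def HasSlope {d : ℕ} (μ : Measure (HeightFunction d)) (s : Slope d) : Prop :=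
  ∀ x : Vertex d, s (embed d x) = ∫ f, ((f x - f 0 : ℤ) : ℝ) ∂μ

/-- Shift-invariant gradient Gibbs measures of slope `s` with Azuma–Hoeffding concentration. -/
structure IsConcentratedGibbs {d : ℕ} (μ : Measure (HeightFunction d)) (s : Slope d) : Prop where
  isProb : IsProbabilityMeasure μ
  shiftInvariant : IsShiftInvariant μ
  gibbs : IsGradientGibbs μ
  slope : HasSlope μ s
  variance_le : ∀ x y : Vertex d,
    ProbabilityTheory.variance (fun f : HeightFunction d => ((f y - f x : ℤ) : ℝ)) μ
      ≤ ((d : ℝ) + 1) ^ 2 * (latticeGraph d).dist x y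
  upper_tail : ∀ x y : Vertex d, 0 < (latticeGraph d).dist x y → ∀ a : ℝ, 0 ≤ a →
    μ.real {f | ((d : ℝ) + 1) * a ≤ ((f y - f x : ℤ) : ℝ) - s (embed d (y - x))}
      ≤ Real.exp (-(a ^ 2 / (2 * (latticeGraph d).dist x y)))
  lower_tail : ∀ x y : Vertex d, 0 < (latticeGraph d).dist x y → ∀ a : ℝ, a ≤ 0 →
    μ.real {f | ((f y - f x : ℤ) : ℝ) - s (embed d (y - x)) ≤ ((d : ℝ) + 1) * a}
      ≤ Real.exp (-(a ^ 2 / (2 * (latticeGraph d).dist x y)))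

/-! ### Specific entropy -/

/-- The differences map `D_R f (x, y) = f(y) - f(x)`, for `x, y ∈ R`. -/
def diffMap {d : ℕ} (R : Finset (Vertex d)) (f : HeightFunction d) : R → R → ℤ :=
  fun x y => f y - f x

/-- The entropy `ℋ_R(μ) = ∑ μ(D_R f = z) log μ(D_R f = z)` over the (finite) image of `D_R`. -/
def entropyIn {d : ℕ} (R : Finset (Vertex d)) (μ : Measure (HeightFunction d)) : ℝ :=
  ∑ᶠ z ∈ Set.range (diffMap R),
    μ.real {f | diffMap R f = z} * Real.log (μ.real {f | diffMap R f = z})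

open Classical in
/-- The specific entropy `ℋ(μ)`: the limit of `|Πₙ|⁻¹ ℋ_{Πₙ}(μ)` if it exists, and the limit
inferior otherwise. -/
def specificEntropy {d : ℕ} (μ : Measure (HeightFunction d)) : ℝ :=
  if ∃ l, Tendsto (fun n : ℕ => 1 / ((box d n).card : ℝ) * entropyIn (box d n) μ) atTop (𝓝 l)
  then limUnder atTop fun n : ℕ => 1 / ((box d n).card : ℝ) * entropyIn (box d n) μ
  else liminf (fun n : ℕ => 1 / ((box d n).card : ℝ) * entropyIn (box d n) μ) atTop

end Stepped

end

noncomputable section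

namespace Stepped

variable {d : ℕ}

/-! ### Coordinates on the lattice -/

/-! Both sides of the equality are computed from the number `N_n(f) = |Ω(Πₙ, f)|`, which is `numMod
(box d n) f`.

Entropy. By the DLR equations, given the gradient on the layer `Πₙ₊₁ ∖ Πₙ`, the configuration in
`Πₙ` is uniform among `N_n(f)` possibilities. Hence the entropy sum in `Πₙ₊₁` is that of the layer
minus the mean of `log N_n` (`entropyIn_box_succ`). The layer has `O(n^(d-1))` vertices, each with
`O(n)` possible heights, so its share is `O(n^(d-1) log n)` and vanishes in the limit. The means of
`log N_n` have a density `t`: modifications in separated translates of a box are independent, and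
shift invariance gives the translates equal means, so the sequence is superadditive
(`exists_tendsto_meanLog`). Thus `ℋ(μ) = -t`.

Surface tension. It remains to show that `log N_n(⌊s⌋)` has the density `t` too. If all `s(𝐠ᵢ) ≤ 1 -
η` with `η > 0`, a height function within `δ n` of `s` can be joined to `⌊s⌋` across an annulus of
width about `δ n / η`, by truncating it between `s - ψ` and `s + ψ` with `ψ` of Lipschitz constant
`η` (`exists_truncation`). This bounds `N_n(f)` by `N_m(⌊s⌋)`, and `N_n(⌊s⌋)` by `N_m(f)`, with `m /
n` close to 1. Concentration and a union bound make the exceptional event improbable, and there `log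
N_n ≤ |Πₙ| log 2` suffices.

If some `s(𝐠ᵢ) = 1`, there is no room to join, but every step in direction `i` goes up, both for
`⌊s⌋` and almost surely under `μ`. Such functions are rigid, so `N_n = 1` and both densities are
zero. -/

/-- The coordinates of a vertex in the basis `gen 0, …, gen (d - 1)`. -/
def coord (d : ℕ) : Vertex d →+ (Fin d → ℤ) :=
  QuotientAddGroup.lift _
    (AddMonoidHom.mk' (fun (x : Fin (d + 1) → ℤ) (i : Fin d) => x i.castSucc - x (Fin.last d))
      (fun x y => by ext i; simp only [Pi.add_apply]; ring))
    (by
      refine AddSubgroup.zmultiples_le_of_mem ?_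
      rw [AddMonoidHom.mem_ker]
      ext i
      simp)

lemma coord_cls (x : Fin (d + 1) → ℤ) (i : Fin d) :
    coord d (cls x) i = x i.castSucc - x (Fin.last d) := rfl

lemma coord_gen_castSucc (i : Fin d) : coord d (gen i.castSucc) = Pi.single i 1 := by
  ext j
  rw [gen, coord_cls, Pi.single_eq_of_ne (Fin.castSucc_ne_last i).symm, sub_zero]
  simp [Pi.single_apply]

lemma coord_gen_last : coord d (gen (Fin.last d)) = -1 := by
  ext j
  rw [gen, coord_cls]
  simp

lemma coord_injective : Function.Injective (coord d) := by
  rw [injective_iff_map_eq_zero]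
  intro x hx
  induction x using QuotientAddGroup.induction_on with
  | H v =>
    rw [QuotientAddGroup.eq_zero_iff, AddSubgroup.mem_zmultiples_iff]
    refine ⟨v (Fin.last d), ?_⟩
    ext i
    induction i using Fin.lastCases with
    | last => simp
    | cast i =>
      have := congrFun hx i
      rw [coord_cls] at this
      simp only [Pi.zero_apply] at this
      simp only [Pi.smul_apply, Pi.one_apply, smul_eq_mul, mul_one]
      omega

/-- The vertex with given coordinates. -/
def ofCoord (a : Fin d → ℤ) : Vertex d := ∑ i, a i • gen i.castSucc

@[simp] lemma coord_ofCoord (a : Fin d → ℤ) : coord d (ofCoord a) = a := by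
  ext j
  simp [ofCoord, map_sum, coord_gen_castSucc, Finset.sum_apply, Pi.single_apply]

@[simp] lemma ofCoord_coord (x : Vertex d) : ofCoord (coord d x) = x :=
  coord_injective (coord_ofCoord _)

lemma ofCoord_injective : Function.Injective (ofCoord (d := d)) := fun a b h => by
  rw [← coord_ofCoord a, h, coord_ofCoord]

instance : Countable (Vertex d) := coord_injective.countable

lemma mem_box {n : ℕ} {x : Vertex d} :
    x ∈ box d n ↔ ∀ i, -(n : ℤ) ≤ coord d x i ∧ coord d x i < n := by
  classical
  simp only [box, Finset.mem_image, Fintype.mem_piFinset, Finset.mem_Ico]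
  constructor
  · rintro ⟨a, ha, rfl⟩ i
    change -(n : ℤ) ≤ coord d (ofCoord a) i ∧ coord d (ofCoord a) i < n
    rw [coord_ofCoord]
    exact ha i
  · intro h
    exact ⟨coord d x, h, ofCoord_coord x⟩

lemma card_box (n : ℕ) : (box d n).card = (2 * n) ^ d := by
  classical
  rw [box, Finset.card_image_of_injective _ (show Function.Injective
    fun a : Fin d → ℤ => ∑ i, a i • gen i.castSucc from ofCoord_injective),
    Fintype.card_piFinset]
  simp only [Int.card_Ico, Finset.prod_const, Finset.card_univ, Fintype.card_fin]
  congr 1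
  omega

lemma coord_gen_mem (i : Fin (d + 1)) (j : Fin d) :
    -1 ≤ coord d (gen i) j ∧ coord d (gen i) j ≤ 1 := by
  induction i using Fin.lastCases with
  | last => rw [coord_gen_last]; simp
  | cast i =>
    rw [coord_gen_castSucc, Pi.single_apply]
    split_ifs <;> simp

lemma add_gen_mem_box {n : ℕ} {x : Vertex d} (hx : x ∈ box d n) (i : Fin (d + 1)) :
    x + gen i ∈ box d (n + 1) := by
  rw [mem_box] at *
  intro j
  have h1 := hx j
  have h2 := coord_gen_mem i j
  rw [map_add, Pi.add_apply]
  push_cast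
  omega

lemma mem_box_of_add_gen {n : ℕ} {x : Vertex d} {i : Fin (d + 1)} (hx : x + gen i ∈ box d n) :
    x ∈ box d (n + 1) := by
  rw [mem_box] at *
  intro j
  have h1 := hx j
  have h2 := coord_gen_mem i j
  rw [map_add, Pi.add_apply] at h1
  push_cast
  omega

lemma box_mono {m n : ℕ} (h : m ≤ n) : box d m ⊆ box d n := by
  intro x hx
  rw [mem_box] at *
  intro i
  have := hx i
  omega

lemma norm_coord_gen_le (i : Fin (d + 1)) : ‖coord d (gen i)‖ ≤ 1 := by
  rw [pi_norm_le_iff_of_nonneg zero_le_one]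
  intro j
  have h := coord_gen_mem i j
  rw [Int.norm_eq_abs, ← Int.cast_abs]
  exact_mod_cast abs_le.mpr h

lemma norm_coord_le_of_mem_box {n : ℕ} {x : Vertex d} (hx : x ∈ box d n) :
    ‖coord d x‖ ≤ n := by
  rw [pi_norm_le_iff_of_nonneg (Nat.cast_nonneg n)]
  intro j
  have h := mem_box.mp hx j
  rw [Int.norm_eq_abs, ← Int.cast_abs]
  exact_mod_cast abs_le.mpr ⟨h.1, h.2.le⟩

lemma le_norm_coord_of_notMem_box {n : ℕ} {x : Vertex d} (hx : x ∉ box d n) :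
    (n : ℝ) ≤ ‖coord d x‖ := by
  rw [mem_box] at hx
  push Not at hx
  obtain ⟨i, hi⟩ := hx
  refine le_trans ?_ (norm_le_pi_norm (coord d x) i)
  rw [Int.norm_eq_abs, ← Int.cast_abs]
  have : (n : ℤ) ≤ |coord d x i| := by
    by_contra hlt
    have := abs_lt.mp (not_le.mp hlt)
    have := hi this.1.le
    omega
  exact_mod_cast this

lemma coord_gen_ne_zero (hd : 1 ≤ d) (i : Fin (d + 1)) : coord d (gen i) ≠ 0 := by
  intro h
  have j : Fin d := ⟨0, hd⟩
  induction i using Fin.lastCases with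
  | last => have := congrFun h j; rw [coord_gen_last] at this; simp at this
  | cast i => have := congrFun h i; rw [coord_gen_castSucc] at this; simp at this

lemma line_injective (hd : 1 ≤ d) (x : Vertex d) (i : Fin (d + 1)) :
    Function.Injective fun k : ℤ => x + k • gen i := by
  intro k l h
  have h' := congrArg (coord d) (add_left_cancel h)
  rw [map_zsmul, map_zsmul] at h'
  exact smul_left_injective ℤ (coord_gen_ne_zero hd i) h'

/-- Every lattice line leaves a finite set, so boundary values can be propagated inwards along it.
-/
lemma exists_add_nsmul_notMem (hd : 1 ≤ d) (R : Finset (Vertex d)) (x : Vertex d)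
    (i : Fin (d + 1)) : ∃ k : ℕ, x + k • gen i ∉ R := by
  by_contra h
  push Not at h
  have hinj : Function.Injective fun k : ℕ => x + k • gen i := by
    intro k l hkl
    have := @line_injective d hd x i k l (by simpa using hkl)
    exact_mod_cast this
  exact Set.infinite_range_of_injective hinj
    ((R.finite_toSet).subset (by rintro _ ⟨k, rfl⟩; exact h k))

lemma exists_sub_nsmul_notMem (hd : 1 ≤ d) (R : Finset (Vertex d)) (x : Vertex d)
    (i : Fin (d + 1)) : ∃ k : ℕ, x - k • gen i ∉ R := by
  by_contra h
  push Not at h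
  have hinj : Function.Injective fun k : ℕ => x - k • gen i := by
    intro k l hkl
    have := @line_injective d hd x i (-k) (-l) (by simpa [sub_eq_add_neg] using hkl)
    simpa using this
  exact Set.infinite_range_of_injective hinj
    ((R.finite_toSet).subset (by rintro _ ⟨k, rfl⟩; exact h k))

/-! ### Distances -/

lemma latticeGraph_adj_add_gen (hd : 1 ≤ d) (x : Vertex d) (i : Fin (d + 1)) :
    (latticeGraph d).Adj x (x + gen i) := by
  rw [latticeGraph, SimpleGraph.fromRel_adj]
  refine ⟨fun h => coord_gen_ne_zero hd i ?_, Or.inl ⟨i, rfl⟩⟩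
  rw [left_eq_add.mp h, map_zero]

lemma exists_walk_zsmul (hd : 1 ≤ d) (x : Vertex d) (i : Fin (d + 1)) (k : ℤ) :
    ∃ w : (latticeGraph d).Walk x (x + k • gen i), w.length = k.natAbs := by
  induction k using Int.induction_on with
  | zero => exact ⟨SimpleGraph.Walk.nil.copy rfl (by simp), by simp⟩
  | succ n ih =>
    obtain ⟨w, hw⟩ := ih
    refine ⟨(w.concat (latticeGraph_adj_add_gen hd _ i)).copy rfl
      (by rw [add_one_zsmul, add_assoc]), ?_⟩
    rw [SimpleGraph.Walk.length_copy, SimpleGraph.Walk.length_concat, hw]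
    omega
  | pred n ih =>
    obtain ⟨w, hw⟩ := ih
    have h := latticeGraph_adj_add_gen hd (x + (-(n : ℤ) - 1) • gen i) i
    rw [add_assoc, ← add_one_zsmul, sub_add_cancel] at h
    refine ⟨w.concat h.symm, ?_⟩
    rw [SimpleGraph.Walk.length_concat, hw]
    omega

lemma exists_walk_sum (hd : 1 ≤ d) (a : Fin d → ℤ) (A : Finset (Fin d)) :
    ∃ w : (latticeGraph d).Walk 0 (∑ i ∈ A, a i • gen i.castSucc),
      w.length = ∑ i ∈ A, (a i).natAbs := by
  classical
  induction A using Finset.induction_on with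
  | empty => exact ⟨SimpleGraph.Walk.nil.copy rfl (by simp), by simp⟩
  | insert j A hj ih =>
    obtain ⟨w, hw⟩ := ih
    obtain ⟨v, hv⟩ := exists_walk_zsmul hd (∑ i ∈ A, a i • gen i.castSucc) j.castSucc (a j)
    refine ⟨(w.append v).copy rfl (by rw [Finset.sum_insert hj, add_comm]), ?_⟩
    rw [SimpleGraph.Walk.length_copy, SimpleGraph.Walk.length_append, hw, hv,
      Finset.sum_insert hj, add_comm]

lemma exists_walk_of_mem_box (hd : 1 ≤ d) {n : ℕ} {x : Vertex d} (hx : x ∈ box d n) :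
    ∃ w : (latticeGraph d).Walk 0 x, w.length ≤ d * n := by
  obtain ⟨w, hw⟩ := exists_walk_sum hd (coord d x) Finset.univ
  have hsum : ∑ i, coord d x i • gen i.castSucc = x := ofCoord_coord x
  refine ⟨w.copy rfl hsum, ?_⟩
  rw [SimpleGraph.Walk.length_copy, hw]
  calc ∑ i, (coord d x i).natAbs ≤ ∑ _i : Fin d, n :=
        Finset.sum_le_sum fun i _ => by have := mem_box.mp hx i; omega
    _ = d * n := by simp

lemma dist_le_of_mem_box (hd : 1 ≤ d) {n : ℕ} {x : Vertex d} (hx : x ∈ box d n) :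
    (latticeGraph d).dist 0 x ≤ d * n := by
  obtain ⟨w, hw⟩ := exists_walk_of_mem_box hd hx
  exact (SimpleGraph.dist_le w).trans hw

lemma dist_pos (hd : 1 ≤ d) {n : ℕ} {x : Vertex d} (hx : x ∈ box d n) (h0 : x ≠ 0) :
    0 < (latticeGraph d).dist 0 x := by
  obtain ⟨w, -⟩ := exists_walk_of_mem_box hd hx
  exact w.reachable.pos_dist_of_ne h0.symm

lemma HeightFunction.abs_sub_le_of_walk (hd : 1 ≤ d) (f : HeightFunction d) {x y : Vertex d}
    (w : (latticeGraph d).Walk x y) : |f y - f x| ≤ d * w.length := by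
  induction w with
  | nil => simp
  | @cons u v z h p ih =>
    rw [latticeGraph, SimpleGraph.fromRel_adj] at h
    have hstep : |f v - f u| ≤ d := by
      rcases h.2 with ⟨i, rfl⟩ | ⟨i, rfl⟩
      · rw [abs_le]
        rcases f.grad u i with h | h <;> omega
      · rw [abs_le]
        rcases f.grad v i with h | h <;> omega
    rw [SimpleGraph.Walk.length_cons]
    push_cast
    have := abs_sub_le (f z) (f v) (f u)
    linarith

lemma HeightFunction.abs_sub_zero_le (hd : 1 ≤ d) (f : HeightFunction d) {n : ℕ} {x : Vertex d}
    (hx : x ∈ box d n) : |f x - f 0| ≤ d * (d * n : ℕ) := by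
  obtain ⟨w, hw⟩ := exists_walk_of_mem_box hd hx
  refine (f.abs_sub_le_of_walk hd w).trans ?_
  gcongr

/-! ### Operations on height functions -/

/-- Addition of a multiple of `d + 1`. -/
def HeightFunction.addConst (f : HeightFunction d) (c : ℤ) (hc : ((d : ℤ) + 1) ∣ c) :
    HeightFunction d where
  toFun x := f x + c
  dvd_zero := dvd_add f.dvd_zero hc
  grad x i := by simpa using f.grad x i

/-- The height function that vanishes at the origin and has the gradient of `f`. -/
def HeightFunction.normalize (f : HeightFunction d) : HeightFunction d :=
  f.addConst (-f 0) ((dvd_neg).mpr f.dvd_zero)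

lemma HeightFunction.normalize_apply (f : HeightFunction d) (x : Vertex d) :
    f.normalize x = f x - f 0 := rfl

/-- Both heights have the residue of `x`. Hence distinct heights at a vertex are at least `d + 1`
apart, which is also the difference between the two possible steps. -/
lemma HeightFunction.dvd_sub (f g : HeightFunction d) (x : Vertex d) :
    ((d : ℤ) + 1) ∣ f x - g x := by
  have h : ((f x - g x : ℤ) : ZMod (d + 1)) = 0 := by
    push_cast
    rw [f.cast_eq_residue, g.cast_eq_residue, sub_self]
  rw [ZMod.intCast_zmod_eq_zero_iff_dvd] at h
  exact_mod_cast h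

open Classical in
/-- The function that equals `g` on `R` and `f` elsewhere. -/
def HeightFunction.glue (R : Set (Vertex d)) (g f : HeightFunction d)
    (h₁ : ∀ x ∈ R, ∀ i, x + gen i ∉ R → g (x + gen i) = f (x + gen i))
    (h₂ : ∀ x ∉ R, ∀ i, x + gen i ∈ R → g x = f x) : HeightFunction d where
  toFun x := if x ∈ R then g x else f x
  dvd_zero := by
    split_ifs
    exacts [g.dvd_zero, f.dvd_zero]
  grad x i := by
    by_cases hx : x ∈ R <;> by_cases hy : x + gen i ∈ R
    · simpa [hx, hy] using g.grad x i
    · simpa [hx, hy, ← h₁ x hx i hy] using g.grad x i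
    · simpa [hx, hy, ← h₂ x hx i hy] using g.grad x i
    · simpa [hx, hy] using f.grad x i

/-- Along an edge, two height functions can be ordered in the same way at both ends. -/
lemma HeightFunction.le_and_le_or (f g : HeightFunction d) (x : Vertex d) (i : Fin (d + 1)) :
    (f x ≤ g x ∧ f (x + gen i) ≤ g (x + gen i)) ∨
      (g x ≤ f x ∧ g (x + gen i) ≤ f (x + gen i)) := by
  obtain ⟨t, ht⟩ := f.dvd_sub g x
  -- If `f x ≠ g x`, the gap is at least `d + 1`, and one edge changes it by at most `d + 1`; so the
  -- order can become equality but cannot reverse.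
  rcases lt_trichotomy t 0 with h | h | h
  · left
    have : ((d : ℤ) + 1) * t ≤ -(d + 1) := by nlinarith
    rcases f.grad x i with a | a <;> rcases g.grad x i with b | b <;> constructor <;> linarith
  · subst h
    rcases le_total (f (x + gen i)) (g (x + gen i)) with h | h
    · exact Or.inl ⟨by linarith, h⟩
    · exact Or.inr ⟨by linarith, h⟩
  · right
    have : (d : ℤ) + 1 ≤ ((d : ℤ) + 1) * t := by nlinarith
    rcases f.grad x i with a | a <;> rcases g.grad x i with b | b <;> constructor <;> linarith

/-- The pointwise maximum. -/
def HeightFunction.max (f g : HeightFunction d) : HeightFunction d where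
  toFun x := Max.max (f x) (g x)
  dvd_zero := by
    rcases max_choice (f 0) (g 0) with h | h <;> rw [h]
    exacts [f.dvd_zero, g.dvd_zero]
  grad x i := by
    rcases f.le_and_le_or g x i with ⟨h, h'⟩ | ⟨h, h'⟩
    · rw [max_eq_right h, max_eq_right h']; exact g.grad x i
    · rw [max_eq_left h, max_eq_left h']; exact f.grad x i

/-- The pointwise minimum. -/
def HeightFunction.min (f g : HeightFunction d) : HeightFunction d where
  toFun x := Min.min (f x) (g x)
  dvd_zero := by
    rcases min_choice (f 0) (g 0) with h | h <;> rw [h]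
    exacts [f.dvd_zero, g.dvd_zero]
  grad x i := by
    rcases f.le_and_le_or g x i with ⟨h, h'⟩ | ⟨h, h'⟩
    · rw [min_eq_left h, min_eq_left h']; exact f.grad x i
    · rw [min_eq_right h, min_eq_right h']; exact g.grad x i

/-! ### Local modifications of height functions -/

/-- The differences `g - f` for `g ∈ Ω(R, f)`, for finite `R`. -/
def modifications (R : Set (Vertex d)) (f : Vertex d → ℤ) : Set (Vertex d → ℤ) :=
  {δ | (∀ x ∉ R, δ x = 0) ∧ ∀ x i,
    (f (x + gen i) + δ (x + gen i)) - (f x + δ x) = 1 ∨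
      (f (x + gen i) + δ (x + gen i)) - (f x + δ x) = -(d : ℤ)}

/-- The number `|Ω(R, f)|` of modifications of `f` in `R`. -/
def numMod (R : Finset (Vertex d)) (f : Vertex d → ℤ) : ℕ :=
  (modifications (R : Set (Vertex d)) f).ncard

lemma ncard_fixedBdry (hd : 1 ≤ d) (R : Finset (Vertex d)) (f : HeightFunction d) :
    (fixedBdry (R : Set (Vertex d)) f).ncard = numMod R f := by
  have himg : modifications (R : Set (Vertex d)) f
      = (fun (g : HeightFunction d) (x : Vertex d) => g x - f x) '' fixedBdry R f := by
    ext δ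
    constructor
    · rintro ⟨h0, h1⟩
      -- Divisibility of `f 0 + δ 0` is not part of the definition of a modification. It follows by
      -- comparing `f` with the normalised `u` at a vertex outside `R`, where `δ` vanishes.
      let u : HeightFunction d :=
        { toFun := fun x => f x + δ x - (f 0 + δ 0)
          dvd_zero := by simp
          grad := fun x i => by
            have := h1 x i
            simpa using this }
      obtain ⟨k, hk⟩ := exists_add_nsmul_notMem hd R 0 0
      have hu := u.dvd_sub f (0 + k • gen 0)
      have hu' : u (0 + k • gen 0) = f (0 + k • gen 0) + 0 - (f 0 + δ 0) := by
        rw [← h0 (0 + k • gen 0) (by simpa using hk)]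
      refine ⟨⟨fun x => f x + δ x, ?_, h1⟩, fun x hx => ?_, ?_⟩
      · rw [hu', ← dvd_neg] at hu
        simpa using hu
      · simp [h0 x hx]
      · ext x; simp
    · rintro ⟨g, hg, rfl⟩
      refine ⟨fun x hx => by simp [hg x hx], fun x i => ?_⟩
      simpa using g.grad x i
  rw [numMod, himg, Set.ncard_image_of_injective]
  intro g g' h
  ext x
  have := congrFun h x
  simpa using this

lemma zero_mem_modifications (R : Set (Vertex d)) (f : HeightFunction d) :
    (0 : Vertex d → ℤ) ∈ modifications R f :=
  ⟨fun _ _ => rfl, fun x i => by simpa using f.grad x i⟩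

/-- A modification in a finite set is determined by the gradient in one direction. -/
lemma modifications_injOn (hd : 1 ≤ d) (R : Finset (Vertex d)) (f : Vertex d → ℤ)
    (i : Fin (d + 1)) :
    Function.Injective fun (δ : modifications (R : Set (Vertex d)) f) (x : R) =>
      decide ((f (x + gen i) + δ.1 (x + gen i)) - (f x + δ.1 x) = 1) := by
  intro δ ε h
  have key : ∀ x, δ.1 (x + gen i) = ε.1 (x + gen i) → δ.1 x = ε.1 x := by
    intro x hx
    by_cases hR : x ∈ R
    · have hb := congrFun h ⟨x, hR⟩
      simp only [decide_eq_decide] at hb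
      rcases δ.2.2 x i with h1 | h1 <;> rcases ε.2.2 x i with h2 | h2
      · omega
      · have := hb.mp h1; omega
      · have := hb.mpr h2; omega
      · omega
    · rw [δ.2.1 x (by simpa using hR), ε.2.1 x (by simpa using hR)]
  ext x
  -- The two modifications agree where the line leaves `R`; `key` carries the agreement back to `x`.
  obtain ⟨k, hk⟩ := exists_add_nsmul_notMem hd R x i
  have hk' : δ.1 (x + k • gen i) = ε.1 (x + k • gen i) := by
    rw [δ.2.1 _ (by simpa using hk), ε.2.1 _ (by simpa using hk)]
  clear hk
  induction k with
  | zero => simpa using hk'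
  | succ k ih =>
    refine ih (key _ ?_)
    rwa [add_assoc, ← succ_nsmul]

lemma finite_modifications (hd : 1 ≤ d) (R : Finset (Vertex d)) (f : Vertex d → ℤ) :
    (modifications (R : Set (Vertex d)) f).Finite :=
  Finite.of_injective _ (modifications_injOn hd R f 0)

lemma numMod_le (hd : 1 ≤ d) (R : Finset (Vertex d)) (f : Vertex d → ℤ) :
    numMod R f ≤ 2 ^ R.card := by
  have h := Nat.card_le_card_of_injective _ (modifications_injOn hd R f 0)
  rw [Nat.card_coe_set_eq] at h
  simpa [numMod] using h

lemma one_le_numMod (hd : 1 ≤ d) (R : Finset (Vertex d)) (f : HeightFunction d) :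
    1 ≤ numMod R f :=
  (Set.ncard_pos (finite_modifications hd R f)).mpr ⟨0, zero_mem_modifications _ f⟩

lemma numMod_mono (hd : 1 ≤ d) {R Q : Finset (Vertex d)} (h : R ⊆ Q) (f : Vertex d → ℤ) :
    numMod R f ≤ numMod Q f :=
  Set.ncard_le_ncard (fun _ hδ => ⟨fun x hx => hδ.1 x fun hx' => hx (h hx'), hδ.2⟩)
    (finite_modifications hd Q f)

/-- `|Ω(R, f)|` depends only on the gradient of `f` on the edges that meet `R`. -/
lemma numMod_congr {R Q : Finset (Vertex d)} {f g : HeightFunction d} {c : ℤ}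
    (h₀ : R ⊆ Q) (h₁ : ∀ x ∈ R, ∀ i, x + gen i ∈ Q) (h₂ : ∀ x i, x + gen i ∈ R → x ∈ Q)
    (hfg : ∀ x ∈ Q, g x = f x + c) : numMod R f = numMod R g := by
  have main : ∀ (f g : HeightFunction d) (c : ℤ), (∀ x ∈ Q, g x = f x + c) →
      modifications (R : Set (Vertex d)) f ⊆ modifications (R : Set (Vertex d)) g := by
    intro f g c hfg δ hδ
    refine ⟨hδ.1, fun x i => ?_⟩
    have h := hδ.2 x i
    by_cases hx : x ∈ R
    · rw [hfg x (h₀ hx), hfg _ (h₁ x hx i)]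
      omega
    by_cases hy : x + gen i ∈ R
    · rw [hfg x (h₂ x i hy), hfg _ (h₀ hy)]
      omega
    · rw [hδ.1 x (by simpa using hx), hδ.1 _ (by simpa using hy)]
      simpa using g.grad x i
  unfold numMod
  congr 1
  exact (main f g c hfg).antisymm (main g f (-c) fun x hx => by rw [hfg x hx]; ring)

lemma numMod_box_congr {n : ℕ} {f g : HeightFunction d} {c : ℤ}
    (hfg : ∀ x ∈ box d (n + 1), g x = f x + c) : numMod (box d n) f = numMod (box d n) g :=
  numMod_congr (box_mono n.le_succ) (fun _ hx i => add_gen_mem_box hx i)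
    (fun _ _ hx => mem_box_of_add_gen hx) hfg

lemma numMod_normalize (R : Finset (Vertex d)) (f : HeightFunction d) :
    numMod R f.normalize = numMod R f := by
  unfold numMod
  congr 1
  ext δ
  simp only [modifications, Set.mem_ofPred_eq, HeightFunction.normalize_apply]
  refine and_congr_right fun _ => forall_congr' fun x => forall_congr' fun i => ?_
  omega

/-- `|Ω(R, f)|` depends only on the values of `f` outside `R`. -/
lemma numMod_eq_of_eqOn_compl (hd : 1 ≤ d) {R : Finset (Vertex d)} {f g : HeightFunction d}
    (h : ∀ x ∉ R, f x = g x) : numMod R f = numMod R g := by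
  rw [← ncard_fixedBdry hd, ← ncard_fixedBdry hd]
  congr 1
  ext u
  refine forall_congr' fun x => forall_congr' fun hx => ?_
  rw [h x (by simpa using hx)]

open Classical in
lemma numMod_translate (R : Finset (Vertex d)) (v : Vertex d) (f : HeightFunction d) :
    numMod (R.image (· + v)) f = numMod R (shift v f) := by
  have himg : modifications (R : Set (Vertex d)) (shift v f)
      = (fun (δ : Vertex d → ℤ) x => δ (x + v)) '' modifications (R.image (· + v)) f := by
    ext δ
    constructor
    · rintro ⟨h0, h1⟩
      refine ⟨fun x => δ (x - v), ⟨fun x hx => h0 _ fun hx' => hx ?_, fun x i => ?_⟩, ?_⟩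
      · simp only [Finset.coe_image, Set.mem_image, Finset.mem_coe]
        exact ⟨x - v, hx', by simp⟩
      · have := h1 (x - v) i
        simp only [shift] at this
        rw [show x - v + gen i + v = x + gen i by abel, sub_add_cancel,
          show x - v + gen i = x + gen i - v by abel] at this
        dsimp only
        omega
      · ext x; simp
    · rintro ⟨ε, ⟨h0, h1⟩, rfl⟩
      refine ⟨fun x hx => h0 _ ?_, fun x i => ?_⟩
      · simpa using hx
      · have := h1 (x + v) i
        rw [show x + v + gen i = x + gen i + v by abel] at this
        simp only [shift]
        omega
  rw [numMod, numMod, himg, Set.ncard_image_of_injective]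
  intro δ ε h
  ext x
  have := congrFun h (x - v)
  simpa using this

/-- Modifications in sets that are pairwise disjoint and not adjacent can be made independently. -/
lemma prod_numMod_le (hd : 1 ≤ d) {ι : Type*} [Fintype ι] (S : ι → Finset (Vertex d))
    (R : Finset (Vertex d)) (hS : ∀ j, S j ⊆ R)
    (hdisj : ∀ j k x, x ∈ S j → x ∈ S k → j = k)
    (hadj : ∀ j k x i, x ∈ S j → x + gen i ∈ S k → j = k) (f : HeightFunction d) :
    ∏ j, numMod (S j) f ≤ numMod R f := by
  classical
  have hsum : ∀ (δ : ∀ j, modifications (S j : Set (Vertex d)) f) (j : ι) (x : Vertex d),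
      (∀ k, k ≠ j → x ∉ S k) → ∑ k, (δ k).1 x = (δ j).1 x := fun δ j x h =>
    Finset.sum_eq_single_of_mem j (Finset.mem_univ j) fun k _ hk =>
      (δ k).2.1 x (by simpa using h k hk)
  have hzero : ∀ (δ : ∀ j, modifications (S j : Set (Vertex d)) f) (x : Vertex d),
      (∀ k, x ∉ S k) → ∑ k, (δ k).1 x = 0 := fun δ x h =>
    Finset.sum_eq_zero fun k _ => (δ k).2.1 x (by simpa using h k)
  -- The independent modifications are added. An edge meets at most one `S j`, so its gradient is
  -- that of a single modification or that of `f`.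
  let Φ : (∀ j, modifications (S j : Set (Vertex d)) f) → modifications (R : Set (Vertex d)) f :=
    fun δ => ⟨fun x => ∑ k, (δ k).1 x, fun x hx => hzero δ x fun k hk => hx (hS k hk), fun x i => by
      dsimp only
      by_cases hx : ∃ j, x ∈ S j
      · obtain ⟨j, hj⟩ := hx
        rw [hsum δ j x fun k hk hxk => hk (hdisj _ _ _ hxk hj),
          hsum δ j (x + gen i) fun k hk hxk => hk (hadj _ _ _ _ hj hxk).symm]
        exact (δ j).2.2 x i
      · push Not at hx
        by_cases hy : ∃ j, x + gen i ∈ S j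
        · obtain ⟨j, hj⟩ := hy
          rw [hsum δ j x fun k _ => hx k,
            hsum δ j (x + gen i) fun k hk hxk => hk (hdisj _ _ _ hxk hj)]
          exact (δ j).2.2 x i
        · push Not at hy
          rw [hzero δ x hx, hzero δ _ hy]
          simpa using f.grad x i⟩
  have hΦ : Function.Injective Φ := by
    intro δ ε h
    ext j x
    by_cases hx : x ∈ S j
    · have hne : ∀ k, k ≠ j → x ∉ S k := fun k hk hxk => hk (hdisj _ _ _ hxk hx)
      rw [← hsum δ j x hne, ← hsum ε j x hne]
      exact congrFun (congrArg Subtype.val h) x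
    · rw [(δ j).2.1 x (by simpa using hx), (ε j).2.1 x (by simpa using hx)]
  have : Finite (modifications (R : Set (Vertex d)) f) := finite_modifications hd R f
  have h := Nat.card_le_card_of_injective Φ hΦ
  rw [Nat.card_pi] at h
  simpa only [numMod, Nat.card_coe_set_eq] using h

/-- If all steps of `f` in one direction go up, then `f` is rigid. -/
lemma numMod_eq_one (hd : 1 ≤ d) (R : Finset (Vertex d)) (f : HeightFunction d) (i : Fin (d + 1))
    (hf : ∀ x, f (x + gen i) - f x = 1) : numMod R f = 1 := by
  rw [numMod, Set.ncard_eq_one]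
  refine ⟨0, Set.eq_singleton_iff_unique_mem.mpr ⟨zero_mem_modifications _ f, fun δ hδ => ?_⟩⟩
  -- A step of 1 cannot be raised, so `δ` is nonincreasing in direction `i`; it vanishes at both
  -- ends of the line, hence throughout.
  have hstep : ∀ x, δ (x + gen i) ≤ δ x := by
    intro x
    have h1 := hf x
    rcases hδ.2 x i with h | h <;> omega
  have hmono : ∀ (k : ℕ) x, δ (x + k • gen i) ≤ δ x := by
    intro k x
    induction k with
    | zero => simp
    | succ k ih =>
      have := hstep (x + k • gen i)
      rw [add_assoc, ← succ_nsmul] at this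
      exact this.trans ih
  ext x
  obtain ⟨k, hk⟩ := exists_add_nsmul_notMem hd R x i
  obtain ⟨l, hl⟩ := exists_sub_nsmul_notMem hd R x i
  have h1 := hmono k x
  have h2 := hmono l (x - l • gen i)
  rw [sub_add_cancel, hδ.1 (x - l • gen i) (by simpa using hl)] at h2
  rw [hδ.1 (x + k • gen i) (by simpa using hk)] at h1
  exact le_antisymm h2 h1

/-! ### Measurability -/

lemma measurable_sub (x y : Vertex d) : Measurable fun f : HeightFunction d => f x - f y := by
  intro A _
  refine MeasurableSpace.le_def.mp
    (le_iSup₂ (f := fun x y : Vertex d => MeasurableSpace.comap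
      (fun f : HeightFunction d => f x - f y) ⊤) x y) _ ⟨A, trivial, rfl⟩

lemma measurable_of_forall_sub {Ω : Type*} [MeasurableSpace Ω] {F : Ω → HeightFunction d}
    (h : ∀ x y, Measurable fun ω => F ω x - F ω y) : Measurable F := by
  rw [measurable_iff_comap_le, gradSigma]
  simp only [MeasurableSpace.comap_iSup, MeasurableSpace.comap_comp]
  exact iSup₂_le fun x y => (h x y).comap_le

lemma measurable_diffMap (R : Finset (Vertex d)) : Measurable (diffMap R) :=
  measurable_pi_iff.mpr fun x => measurable_pi_iff.mpr fun y => measurable_sub y.1 x.1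

/-- The map `diffMap R` takes values in a countable discrete space, so every function of finitely
many gradients is measurable. -/
lemma measurable_of_diffMap {β : Type*} [MeasurableSpace β] (R : Finset (Vertex d))
    {F : HeightFunction d → β} (h : ∀ f g, diffMap R f = diffMap R g → F f = F g) :
    Measurable F := by
  intro A _
  have : F ⁻¹' A = diffMap R ⁻¹' (diffMap R '' (F ⁻¹' A)) := by
    refine (Set.subset_preimage_image _ _).antisymm ?_
    rintro f ⟨g, hg, hgf⟩
    rw [Set.mem_preimage] at *
    rwa [← h g f hgf]
  rw [this]
  exact measurable_diffMap R (Set.to_countable _).measurableSet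

lemma zero_mem_box {n : ℕ} (hn : 0 < n) : (0 : Vertex d) ∈ box d n := by
  rw [mem_box]
  intro i
  simp only [map_zero, Pi.zero_apply]
  omega

lemma diffMap_eq_iff {R : Finset (Vertex d)} {f g : HeightFunction d} :
    diffMap R f = diffMap R g ↔ ∀ x ∈ R, ∀ y ∈ R, f y - f x = g y - g x :=
  ⟨fun h x hx y hy => congrFun (congrFun h ⟨x, hx⟩) ⟨y, hy⟩,
    fun h => funext fun x => funext fun y => h x x.2 y y.2⟩

lemma numMod_box_eq_of_diffMap {n : ℕ} {f g : HeightFunction d}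
    (h : diffMap (box d (n + 1)) f = diffMap (box d (n + 1)) g) :
    numMod (box d n) f = numMod (box d n) g := by
  refine numMod_box_congr (c := g 0 - f 0) fun x hx => ?_
  have := diffMap_eq_iff.mp h 0 (zero_mem_box n.succ_pos) x hx
  omega

lemma measurable_log_numMod (n : ℕ) :
    Measurable fun f : HeightFunction d => Real.log (numMod (box d n) f) :=
  measurable_of_diffMap (box d (n + 1)) fun f g h => by rw [numMod_box_eq_of_diffMap h]

lemma log_numMod_nonneg (hd : 1 ≤ d) (R : Finset (Vertex d)) (f : HeightFunction d) :
    0 ≤ Real.log (numMod R f) :=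
  Real.log_nonneg (by exact_mod_cast one_le_numMod hd R f)

lemma log_numMod_le (hd : 1 ≤ d) (R : Finset (Vertex d)) (f : HeightFunction d) :
    Real.log (numMod R f) ≤ R.card * Real.log 2 := by
  rw [← Real.log_pow]
  refine Real.log_le_log (by exact_mod_cast one_le_numMod hd R f) ?_
  exact_mod_cast numMod_le hd R f

lemma integrable_log_numMod (hd : 1 ≤ d) (μ : Measure (HeightFunction d)) [IsFiniteMeasure μ]
    (n : ℕ) : Integrable (fun f : HeightFunction d => Real.log (numMod (box d n) f)) μ := by
  refine Integrable.of_bound (measurable_log_numMod n).aestronglyMeasurable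
    ((box d n).card * Real.log 2) (Eventually.of_forall fun f => ?_)
  rw [Real.norm_of_nonneg (log_numMod_nonneg hd _ f)]
  exact log_numMod_le hd _ f

/-! ### Shift invariance -/

lemma shift_neg_shift (x : Vertex d) (f : HeightFunction d) : shift (-x) (shift x f) = f := by
  ext y
  simp only [shift, neg_add_cancel_right, zero_add, neg_add_cancel]
  ring

lemma shift_shift_neg (x : Vertex d) (f : HeightFunction d) : shift x (shift (-x) f) = f := by
  simpa using shift_neg_shift (-x) f

lemma measurable_shift (x : Vertex d) : Measurable (shift x : HeightFunction d → _) := by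
  refine measurable_of_forall_sub fun y z => ?_
  convert measurable_sub (y + x) (z + x) using 2
  simp only [shift]
  ring

lemma IsShiftInvariant.measurePreserving {μ : Measure (HeightFunction d)}
    (h : IsShiftInvariant μ) (x : Vertex d) : MeasurePreserving (shift x) μ μ := by
  refine ⟨measurable_shift x, Measure.ext fun A hA => ?_⟩
  rw [Measure.map_apply (measurable_shift x) hA,
    -- Invariance is stated for images; the preimage under the shift by `x` is the image under the
    -- shift by `-x`.
    ← Set.image_eq_preimage_of_inverse (shift_shift_neg x) (shift_neg_shift x)]
  exact h (-x) A hA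

/-! ### The mean logarithm of the number of modifications -/

/-- The mean of `log |Ω(Πₙ, f)|`. -/
def meanLog (μ : Measure (HeightFunction d)) (n : ℕ) : ℝ :=
  ∫ f, Real.log (numMod (box d n) f) ∂μ

lemma meanLog_le (hd : 1 ≤ d) (μ : Measure (HeightFunction d)) [IsProbabilityMeasure μ] (n : ℕ) :
    meanLog μ n ≤ (2 * n : ℝ) ^ d * Real.log 2 := by
  have h : meanLog μ n ≤ ∫ _f, ((box d n).card : ℝ) * Real.log 2 ∂μ :=
    integral_mono (integrable_log_numMod hd μ n) (integrable_const _)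
      fun f => log_numMod_le hd _ f
  rw [card_box] at h
  simpa using h

open Classical in
-- The box `Πₘ` contains `k ^ d` disjoint cells of side `2n + 1`. Each holds a translate of `Πₙ`, of
-- side `2n`; the spare layer keeps translates from being adjacent.
lemma sum_log_numMod_shift_le (hd : 1 ≤ d) {k m n : ℕ} (h : k * (2 * n + 1) ≤ 2 * m)
    (f : HeightFunction d) :
    ∑ j : Fin d → Fin k, Real.log (numMod (box d n)
      (shift (ofCoord fun i => (n : ℤ) - m + (2 * n + 1) * (j i : ℕ)) f))
      ≤ Real.log (numMod (box d m) f) := by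
  let v : (Fin d → Fin k) → Vertex d := fun j =>
    ofCoord fun i => (n : ℤ) - m + (2 * n + 1) * (j i : ℕ)
  let S : (Fin d → Fin k) → Finset (Vertex d) := fun j => (box d n).image (· + v j)
  have hS : ∀ j x, x ∈ S j → ∀ i, (2 * n + 1) * ((j i : ℕ) : ℤ) ≤ coord d x i + m ∧
      coord d x i + m < (2 * n + 1) * ((j i : ℕ) : ℤ) + 2 * n := by
    intro j x hx i
    obtain ⟨y, hy, rfl⟩ := Finset.mem_image.mp hx
    have := mem_box.mp hy i
    rw [map_add, Pi.add_apply, coord_ofCoord]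
    constructor <;> linarith
  -- Consecutive intervals are at distance 2, so coordinates that differ by at most 1 lie in the
  -- same one. The value `e = 0` gives disjointness, the coordinate of a generator gives
  -- non-adjacency.
  have huniq : ∀ (a b : ℕ) (u e : ℤ), (2 * n + 1) * (a : ℤ) ≤ u →
      u < (2 * n + 1) * (a : ℤ) + 2 * n → (2 * n + 1) * (b : ℤ) ≤ u + e →
      u + e < (2 * n + 1) * (b : ℤ) + 2 * n → -1 ≤ e → e ≤ 1 → a = b := by
    intro a b u e h1 h2 h3 h4 h5 h6
    by_contra hne
    rcases Nat.lt_or_gt_of_ne hne with hab | hab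
    · have : (a : ℤ) + 1 ≤ b := by exact_mod_cast hab
      nlinarith
    · have : (b : ℤ) + 1 ≤ a := by exact_mod_cast hab
      nlinarith
  have hprod : ∏ j, numMod (S j) f ≤ numMod (box d m) f := by
    refine prod_numMod_le hd S _ (fun j x hx => mem_box.mpr fun i => ?_) (fun j l x hj hl => ?_)
      (fun j l x i hj hl => ?_) f
    · have h1 := hS j x hx i
      have h2 : ((j i : ℕ) : ℤ) + 1 ≤ k := by exact_mod_cast (j i).2
      have h3 : (k : ℤ) * (2 * n + 1) ≤ 2 * m := by exact_mod_cast h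
      have h4 : (0 : ℤ) ≤ (2 * n + 1) * ((j i : ℕ) : ℤ) := by positivity
      constructor <;> nlinarith
    · ext i
      have h1 := hS j x hj i
      have h2 := hS l x hl i
      exact huniq _ _ (coord d x i + m) 0 h1.1 h1.2 (by linarith) (by linarith) (by simp)
        (by simp)
    · ext i'
      have h1 := hS j x hj i'
      have h2 := hS l _ hl i'
      have h3 := coord_gen_mem i i'
      rw [map_add, Pi.add_apply] at h2
      exact huniq _ _ (coord d x i' + m) (coord d (gen i) i') h1.1 h1.2 (by linarith)
        (by linarith) h3.1 h3.2
  have hpos : ∀ j, (numMod (S j) f : ℝ) ≠ 0 := fun j => by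
    exact_mod_cast (Nat.one_le_iff_ne_zero.mp (one_le_numMod hd (S j) f))
  calc _ = ∑ j, Real.log (numMod (S j) f) :=
        Finset.sum_congr rfl fun j _ => by rw [← numMod_translate]
    _ = Real.log ((∏ j, numMod (S j) f : ℕ) : ℝ) := by
        push_cast
        rw [Real.log_prod fun j _ => hpos j]
    _ ≤ _ := by
        refine Real.log_le_log ?_ (by exact_mod_cast hprod)
        exact_mod_cast Finset.prod_pos fun j _ => one_le_numMod hd (S j) f

lemma meanLog_superadditive (hd : 1 ≤ d) {μ : Measure (HeightFunction d)} [IsProbabilityMeasure μ]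
    (hμ : IsShiftInvariant μ) {k m n : ℕ} (h : k * (2 * n + 1) ≤ 2 * m) :
    (k : ℝ) ^ d * meanLog μ n ≤ meanLog μ m := by
  have hinteg : ∀ v, Integrable
      (fun f : HeightFunction d => Real.log (numMod (box d n) (shift v f))) μ := fun v =>
    ((hμ.measurePreserving v).integrable_comp_of_integrable (integrable_log_numMod hd μ n))
  have hshift : ∀ v, ∫ f, Real.log (numMod (box d n) (shift v f)) ∂μ = meanLog μ n := by
    intro v
    have hmp := hμ.measurePreserving v
    conv_rhs => rw [meanLog, ← hmp.map_eq]
    rw [integral_map hmp.measurable.aemeasurable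
      (measurable_log_numMod n).aestronglyMeasurable]
  have hle := integral_mono (integrable_finsetSum _ fun j _ => hinteg _)
    (integrable_log_numMod hd μ m) fun f => sum_log_numMod_shift_le hd h f
  rw [integral_finsetSum _ fun j _ => hinteg _] at hle
  simp only [hshift] at hle
  simpa [meanLog] using hle

lemma tendsto_natFloor_mul_div {a : ℝ} (ha : 0 ≤ a) :
    Tendsto (fun m : ℕ => (⌊a * m⌋₊ : ℝ) / m) atTop (𝓝 a) :=
  (tendsto_nat_floor_mul_div_atTop ha).comp tendsto_natCast_atTop_atTop

/-- A superadditive sequence on boxes separated by unit gaps has a density. -/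
lemma exists_tendsto_of_box_superadditive {T : ℕ → ℝ} {C : ℝ} (hC : 0 ≤ C)
    (hT : ∀ n : ℕ, T n ≤ (2 * n : ℝ) ^ d * C)
    (hsup : ∀ k m n : ℕ, k * (2 * n + 1) ≤ 2 * m → (k : ℝ) ^ d * T n ≤ T m) :
    ∃ t, Tendsto (fun n : ℕ => T n / (2 * n : ℝ) ^ d) atTop (𝓝 t) := by
  -- Normalising by the volume of a cell, gap included, makes the supremum of `u` the limit.
  let u : ℕ → ℝ := fun n => T n / (2 * n + 1 : ℝ) ^ d
  have hub : ∀ n, u n ≤ C := fun n => by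
    rw [div_le_iff₀ (by positivity), mul_comm]
    refine (hT n).trans ?_
    gcongr
    linarith
  have hbdd : BddAbove (Set.range u) := ⟨C, by rintro _ ⟨n, rfl⟩; exact hub n⟩
  refine ⟨⨆ n, u n, tendsto_order.mpr ⟨fun a ha => ?_, fun b hb => ?_⟩⟩
  · obtain ⟨n, hn⟩ := exists_lt_of_lt_ciSup ha
    -- The number of cells that fit along a side of `Πₘ` is `⌊2m / (2n + 1)⌋`.
    have hlim : Tendsto (fun m : ℕ => ((⌊2 / (2 * n + 1 : ℝ) * m⌋₊ : ℝ) / m * ((2 * n + 1) / 2)) ^ d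
        * u n) atTop (𝓝 ((2 / (2 * n + 1 : ℝ) * ((2 * n + 1) / 2)) ^ d * u n)) :=
      (((tendsto_natFloor_mul_div (by positivity)).mul_const _).pow d).mul_const _
    rw [show (2 / (2 * n + 1 : ℝ) * ((2 * n + 1) / 2)) = 1 by field_simp, one_pow, one_mul] at hlim
    filter_upwards [hlim.eventually_const_lt hn, eventually_gt_atTop 0] with m hm hm0
    refine hm.trans_le ?_
    have hm0' : (0 : ℝ) < m := by exact_mod_cast hm0
    set k := ⌊2 / (2 * n + 1 : ℝ) * m⌋₊ with hk
    have hkm : k * (2 * n + 1) ≤ 2 * m := by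
      have := Nat.floor_le (show 0 ≤ 2 / (2 * n + 1 : ℝ) * m by positivity)
      rw [← hk, div_mul_eq_mul_div, le_div_iff₀ (by positivity)] at this
      exact_mod_cast this
    rw [le_div_iff₀ (by positivity)]
    refine le_trans (le_of_eq ?_) (hsup k m n hkm)
    simp only [u]
    rw [mul_pow, div_pow, div_pow, mul_pow]
    field_simp
  · have hlim : Tendsto (fun n : ℕ => (1 + 1 / 2 * ((n : ℝ))⁻¹) ^ d * ⨆ n, u n) atTop
        (𝓝 ((1 + 1 / 2 * 0) ^ d * ⨆ n, u n)) :=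
      ((tendsto_const_nhds.add
        ((tendsto_inv_atTop_zero.comp tendsto_natCast_atTop_atTop).const_mul _)).pow d).mul_const _
    rw [mul_zero, add_zero, one_pow, one_mul] at hlim
    filter_upwards [hlim.eventually_lt_const hb, eventually_gt_atTop 0] with n hn hn0
    refine lt_of_le_of_lt ?_ hn
    have hn0' : (0 : ℝ) < n := by exact_mod_cast hn0
    have h1 : u n ≤ ⨆ n, u n := le_ciSup hbdd n
    calc T n / (2 * n : ℝ) ^ d = (1 + 1 / 2 * ((n : ℝ))⁻¹) ^ d * u n := by
          simp only [u]
          rw [show (1 + 1 / 2 * ((n : ℝ))⁻¹) = (2 * n + 1) / (2 * n) by field_simp, div_pow]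
          field_simp
      _ ≤ _ := by gcongr

lemma exists_tendsto_meanLog (hd : 1 ≤ d) {μ : Measure (HeightFunction d)}
    [IsProbabilityMeasure μ] (hμ : IsShiftInvariant μ) :
    ∃ t, Tendsto (fun n : ℕ => meanLog μ n / (2 * n : ℝ) ^ d) atTop (𝓝 t) :=
  exists_tendsto_of_box_superadditive (Real.log_nonneg one_le_two)
    (meanLog_le hd μ) fun _ _ _ => meanLog_superadditive hd hμ

/-! ### Entropy -/

/-- The gradient on `R` is determined by the heights relative to the origin, each of modulus at most
`d * (d * n)`. -/
lemma finite_range_diffMap (hd : 1 ≤ d) {R : Finset (Vertex d)} {n : ℕ} (hR : R ⊆ box d n) :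
    (Set.range (diffMap R)).Finite ∧
      (Set.range (diffMap R)).ncard ≤ (2 * (d * (d * n)) + 1) ^ R.card := by
  classical
  let M : ℤ := d * (d * n : ℕ)
  let Z : Finset (R → R → ℤ) :=
    (Fintype.piFinset fun _ : R => Finset.Icc (-M) M).image fun a x y => a y - a x
  have hsub : Set.range (diffMap R) ⊆ (Z : Set (R → R → ℤ)) := by
    rintro _ ⟨f, rfl⟩
    rw [Finset.mem_coe, Finset.mem_image]
    refine ⟨fun x => f x - f 0, ?_, ?_⟩
    · rw [Fintype.mem_piFinset]
      intro x
      rw [Finset.mem_Icc, ← abs_le]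
      exact f.abs_sub_zero_le hd (hR x.2)
    · ext x y
      simp [diffMap]
  refine ⟨Z.finite_toSet.subset hsub, (Set.ncard_le_ncard hsub Z.finite_toSet).trans ?_⟩
  rw [Set.ncard_coe_finset]
  refine Finset.card_image_le.trans (le_of_eq ?_)
  rw [Fintype.card_piFinset]
  simp only [Int.card_Icc, Finset.prod_const, Finset.card_univ, Fintype.card_coe]
  congr 1
  have hM : M = ((d * (d * n) : ℕ) : ℤ) := by simp [M]
  omega

lemma measurableSet_diffMap_eq (R : Finset (Vertex d)) (z : R → R → ℤ) :
    MeasurableSet {f : HeightFunction d | diffMap R f = z} :=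
  measurable_diffMap R (MeasurableSet.singleton z)

lemma integral_comp_diffMap (μ : Measure (HeightFunction d)) [IsFiniteMeasure μ]
    {R : Finset (Vertex d)} (hfin : (Set.range (diffMap R)).Finite) (φ : (R → R → ℤ) → ℝ) :
    ∫ f, φ (diffMap R f) ∂μ
      = ∑ z ∈ hfin.toFinset, μ.real {f | diffMap R f = z} * φ z := by
  have hmeas := measurableSet_diffMap_eq R
  have heq : ∀ f : HeightFunction d, φ (diffMap R f) = ∑ z ∈ hfin.toFinset,
      Set.indicator {f : HeightFunction d | diffMap R f = z} (fun _ => φ z) f := by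
    intro f
    rw [Finset.sum_eq_single_of_mem (diffMap R f) (by simp)]
    · simp
    · intro z _ hz
      exact Set.indicator_of_notMem (fun h : diffMap R f = z => hz h.symm) _
  simp_rw [heq]
  rw [integral_finsetSum _ fun z _ => (integrable_const _).indicator (hmeas z)]
  refine Finset.sum_congr rfl fun z _ => ?_
  rw [integral_indicator_const _ (hmeas z), smul_eq_mul]

/-- As a mean of log-probabilities, the entropy inherits identities between probabilities of
configurations. -/
lemma entropyIn_eq_integral (μ : Measure (HeightFunction d)) [IsFiniteMeasure μ]
    {R : Finset (Vertex d)} (hfin : (Set.range (diffMap R)).Finite) :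
    entropyIn R μ = ∫ f, Real.log (μ.real {g | diffMap R g = diffMap R f}) ∂μ := by
  rw [integral_comp_diffMap μ hfin fun z => Real.log (μ.real {g | diffMap R g = z}), entropyIn,
    finsum_mem_eq_finite_toFinset_sum _ hfin]

lemma sum_real_diffMap (μ : Measure (HeightFunction d)) [IsProbabilityMeasure μ]
    {R : Finset (Vertex d)} (hfin : (Set.range (diffMap R)).Finite) :
    ∑ z ∈ hfin.toFinset, μ.real {f | diffMap R f = z} = 1 := by
  simpa using (integral_comp_diffMap μ hfin fun _ => 1).symm

lemma entropyIn_nonpos (μ : Measure (HeightFunction d)) [IsProbabilityMeasure μ]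
    {R : Finset (Vertex d)} (hfin : (Set.range (diffMap R)).Finite) : entropyIn R μ ≤ 0 := by
  rw [entropyIn, finsum_mem_eq_finite_toFinset_sum _ hfin]
  exact Finset.sum_nonpos fun z _ => mul_nonpos_of_nonneg_of_nonpos measureReal_nonneg
    (Real.log_nonpos measureReal_nonneg measureReal_le_one)

/-- Among laws on a finite set, the uniform one minimises `∑ p log p`. -/
lemma neg_log_ncard_le_entropyIn (μ : Measure (HeightFunction d)) [IsProbabilityMeasure μ]
    {R : Finset (Vertex d)} (hfin : (Set.range (diffMap R)).Finite) :
    -Real.log (Set.range (diffMap R)).ncard ≤ entropyIn R μ := by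
  have hsum := sum_real_diffMap μ hfin
  rw [entropyIn, finsum_mem_eq_finite_toFinset_sum _ hfin, Set.ncard_eq_toFinset_card _ hfin]
  set Z := hfin.toFinset with hZ
  set p : (R → R → ℤ) → ℝ := fun z => μ.real {f | diffMap R f = z} with hp
  change ∑ z ∈ Z, p z = 1 at hsum
  change _ ≤ ∑ z ∈ Z, p z * Real.log (p z)
  have hK : (0 : ℝ) < Z.card := by
    rw [Nat.cast_pos, Finset.card_pos]
    by_contra hne
    rw [Finset.not_nonempty_iff_eq_empty.mp hne] at hsum
    simp at hsum
  -- This is `log x ≤ x - 1` at `x = 1 / (p z * K)`, multiplied by `p z`, with `K` the number of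
  -- configurations.
  have hterm : ∀ z ∈ Z, p z * (-Real.log Z.card) - p z * Real.log (p z) ≤ 1 / Z.card - p z := by
    intro z _
    have hp0 : 0 ≤ p z := measureReal_nonneg
    rcases hp0.eq_or_lt with h | h
    · rw [← h]
      simp
    · have h1 := Real.log_le_sub_one_of_pos (show 0 < (p z * Z.card)⁻¹ by positivity)
      rw [Real.log_inv, Real.log_mul h.ne' hK.ne'] at h1
      have h2 := mul_le_mul_of_nonneg_left h1 h.le
      have h3 : p z * ((p z * Z.card)⁻¹ - 1) = 1 / Z.card - p z := by
        have := h.ne'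
        field_simp
      linarith
  have h := Finset.sum_le_sum hterm
  rw [Finset.sum_sub_distrib, Finset.sum_sub_distrib, ← Finset.sum_mul, hsum, Finset.sum_const,
    nsmul_eq_mul, mul_one_div_cancel hK.ne'] at h
  linarith

lemma ae_pos_real_diffMap (μ : Measure (HeightFunction d)) [IsFiniteMeasure μ]
    (R : Finset (Vertex d)) :
    ∀ᵐ f ∂μ, 0 < μ.real {g | diffMap R g = diffMap R f} := by
  have h : ∀ᵐ f ∂μ, ∀ z, μ {g | diffMap R g = z} = 0 → diffMap R f ≠ z := by
    rw [ae_all_iff]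
    intro z
    by_cases hz : μ {g | diffMap R g = z} = 0
    · have : ∀ᵐ f ∂μ, ¬ diffMap R f = z := by
        rw [ae_iff]
        simpa using hz
      filter_upwards [this] with f hf _ using hf
    · exact Eventually.of_forall fun f h => absurd h hz
  filter_upwards [h] with f hf
  rw [measureReal_def, ENNReal.toReal_pos_iff]
  exact ⟨pos_iff_ne_zero.mpr fun h => hf _ h rfl, measure_lt_top _ _⟩

/-! ### The boundary layer of a box and the DLR equations -/

open Classical in
/-- The layer `Πₙ₊₁ ∖ Πₙ` around `Πₙ`. -/
def shell (d n : ℕ) : Finset (Vertex d) := (box d (n + 1)).filter (· ∉ box d n)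

lemma mem_shell {n : ℕ} {x : Vertex d} : x ∈ shell d n ↔ x ∈ box d (n + 1) ∧ x ∉ box d n := by
  simp [shell]

lemma shell_subset (n : ℕ) : shell d n ⊆ box d (n + 1) := fun _ hx => (mem_shell.mp hx).1

lemma card_shell (n : ℕ) : ((shell d n).card : ℝ) = (2 * (n + 1) : ℝ) ^ d - (2 * n : ℝ) ^ d := by
  classical
  have h := Finset.card_sdiff_add_card_eq_card (box_mono (d := d) n.le_succ)
  have h' : shell d n = box d (n + 1) \ box d n := by
    ext x
    rw [mem_shell, Finset.mem_sdiff]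
  rw [← h', card_box, card_box] at h
  have := congrArg (Nat.cast : ℕ → ℝ) h
  push_cast at this
  linarith

lemma shell_nonempty (hd : 1 ≤ d) (n : ℕ) : (shell d n).Nonempty := by
  refine ⟨ofCoord fun _ => n, mem_shell.mpr ⟨mem_box.mpr fun i => ?_, fun h => ?_⟩⟩
  · rw [coord_ofCoord]
    push_cast
    omega
  · have := mem_box.mp h ⟨0, hd⟩
    rw [coord_ofCoord] at this
    omega

/-- Continuation of the values of `f₀` in a box by `g`, if the gradients agree on the shell. -/
lemma exists_glue_box (hd : 1 ≤ d) {n : ℕ} {f₀ g : HeightFunction d}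
    (h : diffMap (shell d n) g = diffMap (shell d n) f₀) :
    ∃ (u : HeightFunction d) (c : ℤ), (∀ x ∉ box d n, u x = g x) ∧
      ∀ x ∈ box d (n + 1), u x = f₀ x + c := by
  classical
  obtain ⟨b, hb⟩ := shell_nonempty hd n
  have hsh : ∀ x ∈ shell d n, f₀ x + (g b - f₀ b) = g x := fun x hx => by
    have := diffMap_eq_iff.mp h b hb x hx
    omega
  refine ⟨HeightFunction.glue (box d n) (f₀.addConst (g b - f₀ b) (g.dvd_sub f₀ b)) g
    (fun x hx i hi => hsh _ (mem_shell.mpr ⟨add_gen_mem_box hx i, by simpa using hi⟩))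
    (fun x hx i hi => hsh _ (mem_shell.mpr ⟨mem_box_of_add_gen hi, by simpa using hx⟩)),
    g b - f₀ b, fun x hx => ?_, fun x hx => ?_⟩
  · simp [HeightFunction.glue, hx]
  · by_cases hx' : x ∈ box d n
    · simp [HeightFunction.glue, hx', HeightFunction.addConst]
    · simp only [HeightFunction.glue, Finset.mem_coe, hx', if_false]
      exact (hsh x (mem_shell.mpr ⟨hx, hx'⟩)).symm

/-- If `g` has the gradient of `f₀` on the layer, exactly one element of `Ω(Πₙ, g)` continues it
with the gradient of `f₀` inside; otherwise none does. -/
lemma gibbsKernel_diffMap (hd : 1 ≤ d) (n : ℕ) (f₀ g : HeightFunction d) :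
    gibbsKernel (box d n) {f | diffMap (box d (n + 1)) f = diffMap (box d (n + 1)) f₀} g
      = Set.indicator {f | diffMap (shell d n) f = diffMap (shell d n) f₀}
          (fun _ => ((numMod (box d n) f₀ : ℝ≥0∞))⁻¹) g := by
  set A := {f | diffMap (box d (n + 1)) f = diffMap (box d (n + 1)) f₀} with hA
  have hrestr : ∀ u ∈ A, diffMap (shell d n) u = diffMap (shell d n) f₀ := fun u hu =>
    diffMap_eq_iff.mpr fun x hx y hy =>
      diffMap_eq_iff.mp hu x (shell_subset n hx) y (shell_subset n hy)
  by_cases hg : diffMap (shell d n) g = diffMap (shell d n) f₀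
  · rw [Set.indicator_of_mem (s := {f | diffMap (shell d n) f = diffMap (shell d n) f₀}) hg]
    obtain ⟨u, c, hu1, hu2⟩ := exists_glue_box hd hg
    -- The glued function `u` mediates: it has the gradient of `f₀` on `Πₙ₊₁` and the values of `g`
    -- outside `Πₙ`.
    have hN : numMod (box d n) g = numMod (box d n) f₀ := by
      rw [numMod_box_congr hu2]
      exact numMod_eq_of_eqOn_compl hd fun x hx => (hu1 x hx).symm
    have hone : fixedBdry (box d n : Set (Vertex d)) g ∩ A = {u} := by
      refine Set.eq_singleton_iff_unique_mem.mpr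
        ⟨⟨fun x hx => hu1 x (by simpa using hx), diffMap_eq_iff.mpr fun x hx y hy => ?_⟩, ?_⟩
      · rw [hu2 x hx, hu2 y hy]
        ring
      · rintro w ⟨hw1, hw2⟩
        obtain ⟨b, hb⟩ := shell_nonempty hd n
        have hb' := mem_shell.mp hb
        ext x
        by_cases hx : x ∈ box d n
        · have h1 := diffMap_eq_iff.mp hw2 b hb'.1 x (box_mono n.le_succ hx)
          have h2 := hw1 b (by simpa using hb'.2)
          have h3 := hu1 b hb'.2
          have h4 := hu2 b hb'.1
          have h5 := hu2 x (box_mono n.le_succ hx)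
          omega
        · rw [hw1 x (by simpa using hx), hu1 x hx]
    rw [gibbsKernel, hone, ncard_fixedBdry hd, hN]
    simp
  · rw [Set.indicator_of_notMem (s := {f | diffMap (shell d n) f = diffMap (shell d n) f₀}) hg]
    have hempty : fixedBdry (box d n : Set (Vertex d)) g ∩ A = ∅ := by
      refine Set.eq_empty_of_forall_notMem ?_
      rintro u ⟨hu1, hu2⟩
      refine hg ?_
      rw [← hrestr u hu2]
      refine diffMap_eq_iff.mpr fun x hx y hy => ?_
      rw [hu1 x (by simpa using (mem_shell.mp hx).2), hu1 y (by simpa using (mem_shell.mp hy).2)]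
    rw [gibbsKernel, hempty]
    simp

lemma real_diffMap_box (hd : 1 ≤ d) {μ : Measure (HeightFunction d)} (hμ : IsGradientGibbs μ)
    (n : ℕ) (f : HeightFunction d) :
    μ.real {g | diffMap (box d (n + 1)) g = diffMap (box d (n + 1)) f}
      = μ.real {g | diffMap (shell d n) g = diffMap (shell d n) f} / numMod (box d n) f := by
  have h := hμ (box d n) {g | diffMap (box d (n + 1)) g = diffMap (box d (n + 1)) f}
    (measurableSet_diffMap_eq _ _)
  simp only [gibbsKernel_diffMap hd] at h
  rw [lintegral_indicator_const (measurableSet_diffMap_eq _ _)] at h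
  rw [measureReal_def, h, ENNReal.toReal_mul, mul_comm, div_eq_mul_inv, measureReal_def]
  simp

/-- The entropy in a box is that of its boundary layer plus the mean conditional entropy. -/
lemma entropyIn_box_succ (hd : 1 ≤ d) {μ : Measure (HeightFunction d)} [IsProbabilityMeasure μ]
    (hμ : IsGradientGibbs μ) (n : ℕ) :
    entropyIn (box d (n + 1)) μ = entropyIn (shell d n) μ - meanLog μ n := by
  have hfin := (finite_range_diffMap hd (shell_subset (d := d) n)).1
  rw [entropyIn_eq_integral μ (finite_range_diffMap hd (subset_refl _)).1,
    entropyIn_eq_integral μ hfin, meanLog, ← integral_sub _ (integrable_log_numMod hd μ n)]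
  · refine integral_congr_ae ?_
    filter_upwards [ae_pos_real_diffMap μ (shell d n)] with f hf
    rw [real_diffMap_box hd hμ, Real.log_div hf.ne']
    exact_mod_cast Nat.one_le_iff_ne_zero.mp (one_le_numMod hd (box d n) f)
  · have hmeas : Measurable fun f : HeightFunction d =>
        Real.log (μ.real {g | diffMap (shell d n) g = diffMap (shell d n) f}) :=
      measurable_of_diffMap (shell d n) fun f g h => by rw [h]
    obtain ⟨C, hC⟩ := (hfin.image fun z =>
      ‖Real.log (μ.real {g | diffMap (shell d n) g = z})‖).bddAbove
    exact Integrable.of_bound hmeas.aestronglyMeasurable C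
      (Eventually.of_forall fun f => hC ⟨_, ⟨f, rfl⟩, rfl⟩)

lemma abs_entropyIn_shell_le (hd : 1 ≤ d) (μ : Measure (HeightFunction d))
    [IsProbabilityMeasure μ] (n : ℕ) :
    |entropyIn (shell d n) μ|
      ≤ (shell d n).card * Real.log (2 * (d * (d * (n + 1))) + 1) := by
  obtain ⟨hfin, hcard⟩ := finite_range_diffMap hd (shell_subset (d := d) n)
  rw [abs_of_nonpos (entropyIn_nonpos μ hfin), ← Real.log_pow]
  refine (neg_le.mp (neg_log_ncard_le_entropyIn μ hfin)).trans ?_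
  have hpos : 0 < (Set.range (diffMap (shell d n))).ncard := by
    rw [Set.ncard_pos hfin]
    exact ⟨_, lipFloor (fun _ => 0) (fun _ _ => by simp), rfl⟩
  refine Real.log_le_log (by exact_mod_cast hpos) ?_
  exact_mod_cast hcard

lemma card_shell_le (n : ℕ) :
    ((shell d n).card : ℝ) ≤ (2 * (n + 1) : ℝ) ^ d * (d / (n + 1)) := by
  rw [card_shell]
  -- Bernoulli's inequality for `(n / (n + 1)) ^ d = (1 - 1 / (n + 1)) ^ d`.
  have h := one_add_mul_le_pow (a := -(1 / ((n : ℝ) + 1)))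
    (by rw [neg_le_neg_iff, div_le_iff₀ (by positivity)]; linarith [Nat.cast_nonneg (α := ℝ) n]) d
  have h2 : (2 * n : ℝ) ^ d = (2 * (n + 1) : ℝ) ^ d * (1 + -(1 / ((n : ℝ) + 1))) ^ d := by
    rw [← mul_pow]
    congr 1
    field_simp
    ring
  have h3 : (0 : ℝ) ≤ (2 * (n + 1) : ℝ) ^ d := by positivity
  rw [h2]
  have h4 := mul_le_mul_of_nonneg_left h h3
  have h5 : (d : ℝ) / (n + 1) = d * (1 / ((n : ℝ) + 1)) := by ring
  rw [h5]
  linarith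

lemma tendsto_log_affine_div {C : ℝ} (hC : 0 ≤ C) :
    Tendsto (fun n : ℕ => Real.log (C * (n + 1) + 1) / ((n : ℝ) + 1)) atTop (𝓝 0) := by
  have hn : Tendsto (fun n : ℕ => (n : ℝ) + 1) atTop atTop :=
    tendsto_atTop_add_const_right _ _ tendsto_natCast_atTop_atTop
  have h := ((tendsto_inv_atTop_zero.comp hn).const_mul (Real.log (C + 1))).add
    (Real.isLittleO_log_id_atTop.tendsto_div_nhds_zero.comp hn)
  rw [mul_zero, add_zero] at h
  have hn0 : ∀ n : ℕ, (0 : ℝ) ≤ n := fun n => Nat.cast_nonneg n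
  refine squeeze_zero (fun n => ?_) (fun n => ?_) h
  · exact div_nonneg (Real.log_nonneg (by have := hn0 n; nlinarith)) (by positivity)
  · simp only [Function.comp_apply, id_eq]
    rw [← div_eq_mul_inv, ← add_div, ← Real.log_mul (by positivity) (by positivity)]
    gcongr
    have := hn0 n
    nlinarith

lemma tendsto_entropyIn (hd : 1 ≤ d) {μ : Measure (HeightFunction d)} [IsProbabilityMeasure μ]
    (hμ : IsGradientGibbs μ) {t : ℝ}
    (ht : Tendsto (fun n : ℕ => meanLog μ n / (2 * n : ℝ) ^ d) atTop (𝓝 t)) :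
    Tendsto (fun n : ℕ => 1 / ((box d n).card : ℝ) * entropyIn (box d n) μ) atTop (𝓝 (-t)) := by
  rw [← tendsto_add_atTop_iff_nat 1]
  have h1 : Tendsto (fun n : ℕ => entropyIn (shell d n) μ / (2 * (n + 1) : ℝ) ^ d) atTop
      (𝓝 0) := by
    have hlim := (tendsto_log_affine_div (C := 2 * (d * d)) (by positivity)).const_mul (d : ℝ)
    rw [mul_zero] at hlim
    refine squeeze_zero_norm (fun n => ?_) hlim
    have hpos : (0 : ℝ) < (2 * (n + 1) : ℝ) ^ d := by positivity
    rw [Real.norm_eq_abs, abs_div, abs_of_pos hpos, div_le_iff₀ hpos]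
    have hlog : 0 ≤ Real.log (2 * (d * (d * (n + 1))) + 1) :=
      Real.log_nonneg (by linarith [show (0 : ℝ) ≤ 2 * (d * (d * (n + 1))) by positivity])
    refine (abs_entropyIn_shell_le hd μ n).trans
      ((mul_le_mul_of_nonneg_right (card_shell_le n) hlog).trans (le_of_eq ?_))
    rw [show (2 * (d * d) * (n + 1) + 1 : ℝ) = 2 * (d * (d * (n + 1))) + 1 by ring]
    ring
  have h2 : Tendsto (fun n : ℕ => meanLog μ n / (2 * (n + 1) : ℝ) ^ d) atTop (𝓝 t) := by
    have hlim := ht.mul ((tendsto_natCast_div_add_atTop (1 : ℝ)).pow d)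
    rw [one_pow, mul_one] at hlim
    refine hlim.congr' ?_
    filter_upwards [eventually_gt_atTop 0] with n hn
    have : (0 : ℝ) < n := by exact_mod_cast hn
    rw [div_pow, mul_pow, mul_pow]
    field_simp
  have h3 := h1.sub h2
  rw [zero_sub] at h3
  refine h3.congr fun n => ?_
  rw [entropyIn_box_succ hd hμ, card_box]
  push_cast
  ring

/-! ### Attachment of height functions to an affine boundary -/

/-- The height function `⌊s⌋`. -/
abbrev slopeFloor {s : Slope d} (hs : s ∈ lipSlopes d) : HeightFunction d :=
  lipFloor (fun x => s (embed d x)) (isLip_of_mem hs)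

/-- Truncation of `f` to the band of width `ψ` around the slope `s`. -/
lemma exists_truncation {s : Slope d} (hs : s ∈ lipSlopes d) {η : ℝ}
    (hη : ∀ i, s (embed d (gen i)) + η ≤ 1) {ψ : Vertex d → ℝ}
    (hψ : ∀ x i, |ψ (x + gen i) - ψ x| ≤ η) (f : HeightFunction d) :
    ∃ g : HeightFunction d, (∀ x, ψ x = 0 → g x = slopeFloor hs x) ∧
      ∀ x, |f x - s (embed d x)| + (d + 1) ≤ ψ x → g x = f x := by
  -- The slack `η` in the slope pays for the variation of `ψ`, so both barriers can be rounded to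
  -- height functions.
  have hU : IsLip fun x => s (embed d x) + ψ x := fun x i => by
    have h1 := abs_le.mp (hψ x i)
    have h2 := hη i
    simp only [map_add]
    linarith
  have hL : IsLip fun x => s (embed d x) - ψ x := fun x i => by
    have h1 := abs_le.mp (hψ x i)
    have h2 := hη i
    simp only [map_add]
    linarith
  -- Where `ψ = 0` both barriers are `⌊s⌋`. The summand `d + 1` in the second claim absorbs the
  -- rounding of the upper barrier.
  refine ⟨(f.min (lipFloor _ hU)).max (lipFloor _ hL), fun x hx => ?_, fun x hx => ?_⟩
  · have h1 : floorVal (fun x => s (embed d x) + ψ x) x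
        = floorVal (fun x => s (embed d x)) x := by simp [floorVal, hx]
    have h2 : floorVal (fun x => s (embed d x) - ψ x) x
        = floorVal (fun x => s (embed d x)) x := by simp [floorVal, hx]
    simp only [HeightFunction.max, HeightFunction.min, lipFloor]
    rw [h1, h2]
    exact max_eq_right (min_le_right _ _)
  · have h1 := lt_floorVal (fun x => s (embed d x) + ψ x) x
    have h2 := floorVal_le (fun x => s (embed d x) - ψ x) x
    have h3 := neg_abs_le ((f x : ℝ) - s (embed d x))
    have h4 := le_abs_self ((f x : ℝ) - s (embed d x))
    have h5 : (0 : ℝ) ≤ d := Nat.cast_nonneg d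
    have h6 : f x ≤ floorVal (fun x => s (embed d x) + ψ x) x := by
      have : (f x : ℝ) ≤ floorVal (fun x => s (embed d x) + ψ x) x := by linarith
      exact_mod_cast this
    have h7 : floorVal (fun x => s (embed d x) - ψ x) x ≤ f x := by
      have : (floorVal (fun x => s (embed d x) - ψ x) x : ℝ) ≤ f x := by linarith
      exact_mod_cast this
    simp only [HeightFunction.max, HeightFunction.min, lipFloor]
    rw [min_eq_left h6, max_eq_left h7]

lemma abs_norm_coord_add_gen_sub_le (x : Vertex d) (i : Fin (d + 1)) :
    |‖coord d (x + gen i)‖ - ‖coord d x‖| ≤ 1 := by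
  refine (abs_norm_sub_norm_le _ _).trans ?_
  rw [map_add, add_sub_cancel_left]
  exact norm_coord_gen_le i

lemma abs_mul_max_sub_le {η a b : ℝ} (hη : 0 ≤ η) (h : |a - b| ≤ 1) :
    |η * max a 0 - η * max b 0| ≤ η := by
  rw [← mul_sub, abs_mul, abs_of_nonneg hη]
  have := (abs_max_sub_max_le_abs a b 0).trans h
  exact mul_le_of_le_one_right hη this

/-- Attachment of `f` inside to `⌊s⌋` outside. -/
lemma numMod_le_numMod_slopeFloor (hd : 1 ≤ d) {s : Slope d} (hs : s ∈ lipSlopes d) {η : ℝ}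
    (hη0 : 0 ≤ η) (hη : ∀ i, s (embed d (gen i)) + η ≤ 1) {m n : ℕ} (hmn : n ≤ m)
    {f : HeightFunction d}
    (hf : ∀ x ∈ box d (n + 1), |f x - s (embed d x)| + (d + 1) ≤ η * (m - n - 1)) :
    numMod (box d n) f ≤ numMod (box d m) (slopeFloor hs) := by
  obtain ⟨g, hg1, hg2⟩ := exists_truncation hs hη
    -- This `ψ` vanishes outside `Πₘ` and is at least `η * (m - n - 1)` on `Πₙ₊₁`.
    (ψ := fun x => η * max (m - ‖coord d x‖) 0)
    (fun x i => abs_mul_max_sub_le hη0 (by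
      rw [sub_sub_sub_cancel_left, abs_sub_comm]
      exact abs_norm_coord_add_gen_sub_le x i)) f
  have h1 : ∀ x ∈ box d (n + 1), g x = f x + 0 := fun x hx => by
    rw [add_zero]
    refine hg2 x ((hf x hx).trans ?_)
    have := norm_coord_le_of_mem_box hx
    push_cast at this
    exact mul_le_mul_of_nonneg_left (le_max_of_le_left (by linarith)) hη0
  have h2 : ∀ x ∉ box d m, g x = slopeFloor hs x := fun x hx => hg1 x (by
    have := le_norm_coord_of_notMem_box hx
    rw [max_eq_right (by linarith), mul_zero])
  rw [numMod_box_congr h1, ← numMod_eq_of_eqOn_compl hd h2]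
  exact numMod_mono hd (box_mono hmn) _

/-- Attachment of `⌊s⌋` inside to `f` outside. -/
lemma numMod_slopeFloor_le_numMod (hd : 1 ≤ d) {s : Slope d} (hs : s ∈ lipSlopes d) {η : ℝ}
    (hη0 : 0 ≤ η) (hη : ∀ i, s (embed d (gen i)) + η ≤ 1) {m n : ℕ} (hmn : n + 1 ≤ m)
    {f : HeightFunction d}
    (hf : ∀ x ∈ box d (m + 1), |f x - s (embed d x)| + (d + 1) ≤ η * (m - n - 1)) :
    numMod (box d n) (slopeFloor hs) ≤ numMod (box d m) f := by
  obtain ⟨g, hg1, hg2⟩ := exists_truncation hs hη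
    -- This `ψ` vanishes on `Πₙ₊₁` and is at least `η * (m - n - 1)` outside `Πₘ`.
    (ψ := fun x => η * max (‖coord d x‖ - (n + 1)) 0)
    (fun x i => abs_mul_max_sub_le hη0 (by
      rw [sub_sub_sub_cancel_right]
      exact abs_norm_coord_add_gen_sub_le x i)) f
  have h1 : ∀ x ∈ box d (n + 1), g x = slopeFloor hs x := fun x hx => hg1 x (by
    have := norm_coord_le_of_mem_box hx
    push_cast at this
    rw [max_eq_right (by linarith), mul_zero])
  have h2 : ∀ x ∈ box d (m + 1), x ∉ box d m → g x = f x := fun x hx hx' => by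
    refine hg2 x ((hf x hx).trans ?_)
    have := le_norm_coord_of_notMem_box hx'
    exact mul_le_mul_of_nonneg_left (le_max_of_le_left (by linarith)) hη0
  -- Closeness of `f` to `s` is known on `Πₘ₊₁` only, so the truncation is kept inside `Πₘ` and
  -- continued by `f` itself.
  let u := HeightFunction.glue (box d m : Set (Vertex d)) g f
    (fun x hx i hi => h2 _ (add_gen_mem_box hx i) (by simpa using hi))
    (fun x hx i hi => h2 _ (mem_box_of_add_gen hi) (by simpa using hx))
  have h3 : ∀ x ∈ box d (n + 1), u x = slopeFloor hs x + 0 := fun x hx => by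
    rw [add_zero, ← h1 x hx]
    simp [u, HeightFunction.glue, box_mono hmn hx]
  have h4 : ∀ x ∉ box d m, u x = f x := fun x hx => by
    simp [u, HeightFunction.glue, hx]
  rw [numMod_box_congr h3, ← numMod_eq_of_eqOn_compl hd h4]
  exact numMod_mono hd (box_mono (by omega)) _

/-! ### Concentration -/

/-- The event that `f` deviates from the slope `s` by more than `r` somewhere in `Πₙ`. -/
def deviation (s : Slope d) (n : ℕ) (r : ℝ) : Set (HeightFunction d) :=
  ⋃ x ∈ box d n, {f | r < |((f x - f 0 : ℤ) : ℝ) - s (embed d x)|}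

lemma measurableSet_deviation (s : Slope d) (n : ℕ) (r : ℝ) :
    MeasurableSet (deviation s n r) := by
  refine Finset.measurableSet_biUnion _ fun x _ => ?_
  exact measurable_sub x 0 (t := {k : ℤ | r < |(k : ℝ) - s (embed d x)|}) trivial

lemma abs_normalize_sub_le {s : Slope d} {n : ℕ} {r : ℝ} {f : HeightFunction d}
    (hf : f ∉ deviation s n r) {x : Vertex d} (hx : x ∈ box d n) :
    |(f.normalize x : ℝ) - s (embed d x)| ≤ r := by
  by_contra h
  exact hf (Set.mem_biUnion hx (not_le.mp h))

/-- The distance from the origin is at most `d * n`, so a deviation of order `n` makes the Gaussian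
exponent linear in `n`. -/
lemma real_abs_sub_gt_le (hd : 1 ≤ d) {μ : Measure (HeightFunction d)} {s : Slope d}
    (hμ : IsConcentratedGibbs μ s) {δ : ℝ} (hδ : 0 < δ) {n : ℕ} (hn : 0 < n) {x : Vertex d}
    (hx : x ∈ box d n) :
    μ.real {f | δ * n < |((f x - f 0 : ℤ) : ℝ) - s (embed d x)|}
      ≤ 2 * Real.exp (-(δ ^ 2 / (2 * d * (d + 1) ^ 2) * n)) := by
  have := hμ.isProb
  rcases eq_or_ne x 0 with rfl | hx0
  · have hempty : {f : HeightFunction d | δ * n < |((f 0 - f 0 : ℤ) : ℝ) - s (embed d 0)|} = ∅ := by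
      refine Set.eq_empty_of_forall_notMem fun f hf => ?_
      have hf' : δ * n < |((f 0 - f 0 : ℤ) : ℝ) - s (embed d 0)| := hf
      simp only [sub_self, Int.cast_zero, map_zero, abs_zero] at hf'
      exact absurd hf' (not_lt.mpr (by positivity))
    rw [hempty, measureReal_empty]
    positivity
  · have hpos := dist_pos hd hx hx0
    have hle : ((latticeGraph d).dist 0 x : ℝ) ≤ d * n := by
      exact_mod_cast dist_le_of_mem_box hd hx
    have hpos' : (0 : ℝ) < (latticeGraph d).dist 0 x := by exact_mod_cast hpos
    have hd0 : (0 : ℝ) < d := by exact_mod_cast hd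
    have hn0 : (0 : ℝ) < n := by exact_mod_cast hn
    set a : ℝ := δ * n / (d + 1) with ha
    have ha0 : 0 ≤ a := by positivity
    have hda : ((d : ℝ) + 1) * a = δ * n := by rw [ha]; field_simp
    have hexp : Real.exp (-(a ^ 2 / (2 * (latticeGraph d).dist 0 x)))
        ≤ Real.exp (-(δ ^ 2 / (2 * d * (d + 1) ^ 2) * n)) := by
      rw [Real.exp_le_exp, neg_le_neg_iff]
      have : δ ^ 2 / (2 * d * (d + 1) ^ 2) * n = a ^ 2 / (2 * (d * n)) := by
        rw [ha]; field_simp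
      rw [this]
      gcongr
    have hup := (hμ.upper_tail 0 x hpos a ha0).trans hexp
    have hlow := hμ.lower_tail 0 x hpos (-a) (by linarith)
    rw [neg_sq] at hlow
    have hlow := hlow.trans hexp
    rw [sub_zero, hda] at hup
    rw [sub_zero, mul_neg, hda] at hlow
    refine (measureReal_mono (fun f hf => ?_) (measure_ne_top _ _)).trans
      ((measureReal_union_le _ _).trans ((add_le_add hup hlow).trans_eq (two_mul _).symm))
    rcases lt_abs.mp (show δ * n < |((f x - f 0 : ℤ) : ℝ) - s (embed d x)| from hf) with h | h
    · exact Or.inl h.le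
    · exact Or.inr (by
        change ((f x - f 0 : ℤ) : ℝ) - s (embed d x) ≤ -(δ * n)
        linarith)

lemma tendsto_real_deviation (hd : 1 ≤ d) {μ : Measure (HeightFunction d)} {s : Slope d}
    (hμ : IsConcentratedGibbs μ s) {δ : ℝ} (hδ : 0 < δ) :
    Tendsto (fun n : ℕ => μ.real (deviation s n (δ * n))) atTop (𝓝 0) := by
  have hd0 : (0 : ℝ) < d := by exact_mod_cast hd
  set c : ℝ := δ ^ 2 / (2 * d * (d + 1) ^ 2) with hc
  have hc0 : 0 < c := by positivity
  have hcn : Tendsto (fun n : ℕ => c * (n : ℝ)) atTop atTop :=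
    tendsto_natCast_atTop_atTop.const_mul_atTop hc0
  -- Union bound over `(2n) ^ d` vertices; the factor `(2 / c) ^ d` turns `(c n) ^ d` into `(2n) ^
  -- d`.
  have hlim := ((Real.tendsto_pow_mul_exp_neg_atTop_nhds_zero d).comp hcn).const_mul
    (2 * (2 / c) ^ d)
  rw [mul_zero] at hlim
  refine squeeze_zero' (Eventually.of_forall fun n => measureReal_nonneg) ?_ hlim
  filter_upwards [eventually_gt_atTop 0] with n hn
  refine (measureReal_biUnion_finset_le _ _).trans
    ((Finset.sum_le_sum fun x hx => real_abs_sub_gt_le hd hμ hδ hn hx).trans (le_of_eq ?_))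
  rw [Finset.sum_const, card_box, nsmul_eq_mul, ← hc]
  simp only [Function.comp_apply]
  push_cast
  rw [mul_pow, mul_pow, div_pow]
  field_simp

/-! ### Comparison of the surface tension with the mean logarithm -/

section Comparison

variable {μ : Measure (HeightFunction d)} [IsProbabilityMeasure μ] {s : Slope d} {η r : ℝ}
  {m n : ℕ}

/-- Off the deviation event `f` can be attached to `⌊s⌋`; on it, `log N_n ≤ |Πₙ| log 2` is used. -/
lemma meanLog_le_log_numMod_slopeFloor (hd : 1 ≤ d) (hs : s ∈ lipSlopes d) (hη0 : 0 ≤ η)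
    (hη : ∀ i, s (embed d (gen i)) + η ≤ 1) (hmn : n ≤ m) (hr : r + (d + 1) ≤ η * (m - n - 1)) :
    meanLog μ n ≤ Real.log (numMod (box d m) (slopeFloor hs))
      + μ.real (deviation s (n + 1) r) * ((2 * n : ℝ) ^ d * Real.log 2) := by
  have hcard : ((box d n).card : ℝ) = (2 * n : ℝ) ^ d := by rw [card_box]; push_cast; rfl
  have hD := measurableSet_deviation s (n + 1) r
  have hpt : ∀ f : HeightFunction d, Real.log (numMod (box d n) f)
      ≤ Real.log (numMod (box d m) (slopeFloor hs))
        + (deviation s (n + 1) r).indicator (fun _ => (2 * n : ℝ) ^ d * Real.log 2) f := by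
    intro f
    by_cases hf : f ∈ deviation s (n + 1) r
    · rw [Set.indicator_of_mem hf, ← hcard]
      linarith [log_numMod_le hd (box d n) f, log_numMod_nonneg hd (box d m) (slopeFloor hs)]
    · rw [Set.indicator_of_notMem hf, add_zero, ← numMod_normalize]
      refine Real.log_le_log (by exact_mod_cast one_le_numMod hd _ _) ?_
      exact_mod_cast numMod_le_numMod_slopeFloor hd hs hη0 hη hmn fun x hx =>
        (add_le_add_left (abs_normalize_sub_le hf hx) _).trans hr
  have h := integral_mono (integrable_log_numMod hd μ n)
    ((integrable_const (μ := μ) _).add ((integrable_const _).indicator hD)) hpt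
  simp only [Pi.add_apply] at h
  rw [integral_add (integrable_const _) ((integrable_const _).indicator hD),
    integral_indicator_const _ hD] at h
  simpa [meanLog] using h

lemma log_numMod_slopeFloor_le_meanLog (hd : 1 ≤ d) (hs : s ∈ lipSlopes d) (hη0 : 0 ≤ η)
    (hη : ∀ i, s (embed d (gen i)) + η ≤ 1) (hmn : n + 1 ≤ m)
    (hr : r + (d + 1) ≤ η * (m - n - 1)) :
    Real.log (numMod (box d n) (slopeFloor hs)) ≤ meanLog μ m
      + μ.real (deviation s (m + 1) r) * ((2 * n : ℝ) ^ d * Real.log 2) := by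
  have hcard : ((box d n).card : ℝ) = (2 * n : ℝ) ^ d := by rw [card_box]; push_cast; rfl
  have hD := measurableSet_deviation s (m + 1) r
  have hpt : ∀ f : HeightFunction d, Real.log (numMod (box d n) (slopeFloor hs))
      ≤ Real.log (numMod (box d m) f)
        + (deviation s (m + 1) r).indicator (fun _ => (2 * n : ℝ) ^ d * Real.log 2) f := by
    intro f
    by_cases hf : f ∈ deviation s (m + 1) r
    · rw [Set.indicator_of_mem hf, ← hcard]
      linarith [log_numMod_le hd (box d n) (slopeFloor hs), log_numMod_nonneg hd (box d m) f]
    · rw [Set.indicator_of_notMem hf, add_zero, ← numMod_normalize _ f]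
      refine Real.log_le_log (by exact_mod_cast one_le_numMod hd _ _) ?_
      exact_mod_cast numMod_slopeFloor_le_numMod hd hs hη0 hη hmn fun x hx =>
        (add_le_add_left (abs_normalize_sub_le hf hx) _).trans hr
  have h := integral_mono (integrable_const (μ := μ) _)
    ((integrable_log_numMod hd μ m).add ((integrable_const _).indicator hD)) hpt
  simp only [Pi.add_apply] at h
  rw [integral_add (integrable_log_numMod hd μ m) ((integrable_const _).indicator hD),
    integral_indicator_const _ hD] at h
  simpa [meanLog] using h

end Comparison

/-! ### Limits -/

lemma eventually_le_mul_natCast {c : ℝ} (hc : 0 < c) (C : ℝ) : ∀ᶠ n : ℕ in atTop, C ≤ c * n :=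
  (tendsto_natCast_atTop_atTop.const_mul_atTop hc).eventually_ge_atTop C

lemma tendsto_natFloor_mul_atTop {a : ℝ} (ha : 0 < a) :
    Tendsto (fun m : ℕ => ⌊a * (m : ℝ)⌋₊) atTop atTop :=
  tendsto_nat_floor_atTop.comp (tendsto_natCast_atTop_atTop.const_mul_atTop ha)

section Interior

variable {μ : Measure (HeightFunction d)} {s : Slope d} {η t : ℝ}

lemma eventually_lt_log_numMod (hd : 1 ≤ d) (hμ : IsConcentratedGibbs μ s) (hs : s ∈ lipSlopes d)
    (hη0 : 0 < η) (hη : ∀ i, s (embed d (gen i)) + η ≤ 1)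
    (ht : Tendsto (fun n : ℕ => meanLog μ n / (2 * n : ℝ) ^ d) atTop (𝓝 t)) {a : ℝ} (ha : a < t) :
    ∀ᶠ m : ℕ in atTop, a < Real.log (numMod (box d m) (slopeFloor hs)) / (2 * m : ℝ) ^ d := by
  have := hμ.isProb
  have hcont : Tendsto (fun θ : ℝ => θ ^ d * t) (𝓝[<] 1) (𝓝 t) := by
    have h : Tendsto (fun θ : ℝ => θ ^ d * t) (𝓝 1) (𝓝 (1 ^ d * t)) :=
      ((continuous_pow d).mul continuous_const).tendsto 1
    rw [one_pow, one_mul] at h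
    exact h.mono_left nhdsWithin_le_nhds
  obtain ⟨θ, hθa, hθ0, hθ1⟩ := ((hcont.eventually_const_lt ha).and
    (Ioo_mem_nhdsLT (zero_lt_one (α := ℝ)))).exists
  -- With `n = ⌊θ m⌋`, the annulus allows `η * (m - n) ≥ 2 * δ * m`. Half of it covers the
  -- deviation, the other half the bounded terms for large `m`.
  set δ : ℝ := η * (1 - θ) / 2 with hδ
  have hδ0 : 0 < δ := by
    have : 0 < 1 - θ := by linarith
    positivity
  have hN := tendsto_natFloor_mul_atTop hθ0
  have hp := (tendsto_real_deviation hd hμ hδ0).comp ((tendsto_add_atTop_nat 1).comp hN)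
  have hratio := (tendsto_natFloor_mul_div hθ0.le).pow d
  have hlim := hratio.mul ((ht.comp hN).sub (hp.mul_const (Real.log 2)))
  rw [zero_mul, sub_zero] at hlim
  filter_upwards [hlim.eventually_const_lt hθa, hN.eventually_gt_atTop 0, eventually_gt_atTop 0,
    eventually_le_mul_natCast hδ0 (δ + (d + 1) + η)] with m hm hn0 hm0 hlarge
  refine hm.trans_le ?_
  simp only [Function.comp_apply]
  set n := ⌊θ * (m : ℝ)⌋₊ with hn
  have hm0' : (0 : ℝ) < m := by exact_mod_cast hm0
  have hn0' : (0 : ℝ) < n := by exact_mod_cast hn0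
  have hnm : (n : ℝ) ≤ θ * m := Nat.floor_le (by positivity)
  have hnm' : (n : ℝ) ≤ m := hnm.trans (mul_le_of_le_one_left hm0'.le hθ1.le)
  have h := meanLog_le_log_numMod_slopeFloor (μ := μ) (r := δ * (n + 1 : ℕ)) hd hs hη0.le hη
    (m := m) (n := n) (by exact_mod_cast hnm') (by
      have h1 : δ * n ≤ δ * m := by gcongr
      have h2 : η * (m - θ * m) = 2 * (δ * m) := by rw [hδ]; ring
      have h3 : η * (m - θ * m) ≤ η * (m - n) := by gcongr
      push_cast
      linarith)
  rw [le_div_iff₀ (by positivity)]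
  have h2 : (n / m : ℝ) ^ d * (meanLog μ n / (2 * n : ℝ) ^ d
      - μ.real (deviation s (n + 1) (δ * (n + 1 : ℕ))) * Real.log 2) * (2 * m : ℝ) ^ d
      = meanLog μ n - μ.real (deviation s (n + 1) (δ * (n + 1 : ℕ)))
        * ((2 * n : ℝ) ^ d * Real.log 2) := by
    rw [div_pow, mul_pow, mul_pow]
    field_simp
  rw [h2]
  linarith

lemma eventually_log_numMod_lt (hd : 1 ≤ d) (hμ : IsConcentratedGibbs μ s) (hs : s ∈ lipSlopes d)
    (hη0 : 0 < η) (hη : ∀ i, s (embed d (gen i)) + η ≤ 1)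
    (ht : Tendsto (fun n : ℕ => meanLog μ n / (2 * n : ℝ) ^ d) atTop (𝓝 t)) {b : ℝ} (hb : t < b) :
    ∀ᶠ n : ℕ in atTop, Real.log (numMod (box d n) (slopeFloor hs)) / (2 * n : ℝ) ^ d < b := by
  have := hμ.isProb
  have hcont : Tendsto (fun κ : ℝ => κ ^ d * t) (𝓝[>] 1) (𝓝 t) := by
    have h : Tendsto (fun κ : ℝ => κ ^ d * t) (𝓝 1) (𝓝 (1 ^ d * t)) :=
      ((continuous_pow d).mul continuous_const).tendsto 1
    rw [one_pow, one_mul] at h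
    exact h.mono_left nhdsWithin_le_nhds
  obtain ⟨κ, hκb, hκ1⟩ := ((hcont.eventually_lt_const hb).and self_mem_nhdsWithin).exists
  have hκ1' : 0 < κ - 1 := sub_pos.mpr hκ1
  have hκ0 : 0 < κ := by linarith
  -- With `m = ⌊κ n⌋`, the deviation `δ * m` is at most `η * (κ - 1) * n / 2`, half the allowance of
  -- the annulus up to bounded terms.
  set δ : ℝ := η * (κ - 1) / (2 * κ) with hδ
  have hδ0 : 0 < δ := by positivity
  have hN := tendsto_natFloor_mul_atTop hκ0
  have hp := (tendsto_real_deviation hd hμ hδ0).comp ((tendsto_add_atTop_nat 1).comp hN)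
  have hratio := (tendsto_natFloor_mul_div hκ0.le).pow d
  have hlim := (hratio.mul (ht.comp hN)).add (hp.mul_const (Real.log 2))
  rw [zero_mul, add_zero] at hlim
  filter_upwards [hlim.eventually_lt_const hκb, hN.eventually_gt_atTop 0, eventually_gt_atTop 0,
    eventually_le_mul_natCast (c := η * (κ - 1) / 2) (by positivity) (δ + (d + 1) + 2 * η),
    eventually_le_mul_natCast hκ1' 2] with n hn hm0 hn0 hlarge hlarge'
  refine lt_of_le_of_lt ?_ hn
  simp only [Function.comp_apply]
  set m := ⌊κ * (n : ℝ)⌋₊ with hm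
  have hm0' : (0 : ℝ) < m := by exact_mod_cast hm0
  have hn0' : (0 : ℝ) < n := by exact_mod_cast hn0
  have hmn : (m : ℝ) ≤ κ * n := Nat.floor_le (by positivity)
  have hmn' : κ * n < m + 1 := Nat.lt_floor_add_one _
  have h := log_numMod_slopeFloor_le_meanLog (μ := μ) (r := δ * (m + 1 : ℕ)) hd hs hη0.le hη
    (m := m) (n := n) (by
      have : ((n + 1 : ℕ) : ℝ) ≤ m := by push_cast; linarith
      exact_mod_cast this) (by
      have h1 : δ * m ≤ δ * (κ * n) := by gcongr
      have h2 : δ * (κ * n) = η * (κ - 1) / 2 * n := by rw [hδ]; field_simp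
      have h3 : η * (κ * n - 1 - n - 1) ≤ η * (m - n - 1) := by
        gcongr
        linarith
      push_cast
      linarith)
  rw [div_le_iff₀ (by positivity)]
  have h2 : ((m / n : ℝ) ^ d * (meanLog μ m / (2 * m : ℝ) ^ d)
      + μ.real (deviation s (m + 1) (δ * (m + 1 : ℕ))) * Real.log 2) * (2 * n : ℝ) ^ d
      = meanLog μ m + μ.real (deviation s (m + 1) (δ * (m + 1 : ℕ)))
        * ((2 * n : ℝ) ^ d * Real.log 2) := by
    rw [div_pow, mul_pow, mul_pow]
    field_simp
  rw [h2]
  exact h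

end Interior

lemma tensionSeq_eq (hd : 1 ≤ d) {s : Slope d} (hs : s ∈ lipSlopes d) (n : ℕ) :
    tensionSeq s hs n = -(Real.log (numMod (box d n) (slopeFloor hs)) / (2 * n : ℝ) ^ d) := by
  rw [tensionSeq, ncard_fixedBdry hd, card_box]
  push_cast
  ring

/-! ### Extremal slopes -/

/-- Rounding loses less than `d + 1`, so while `s` rises by 1 its floor cannot fall by `d`. -/
lemma slopeFloor_step {s : Slope d} (hs : s ∈ lipSlopes d) {i : Fin (d + 1)}
    (hi : s (embed d (gen i)) = 1) (x : Vertex d) :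
    slopeFloor hs (x + gen i) - slopeFloor hs x = 1 := by
  refine ((slopeFloor hs).grad x i).resolve_right fun h => ?_
  have h1 := lt_floorVal (fun x => s (embed d x)) (x + gen i)
  have h2 := floorVal_le (fun x => s (embed d x)) x
  have h3 : (floorVal (fun x => s (embed d x)) (x + gen i) : ℝ)
      - floorVal (fun x => s (embed d x)) x = -d := by exact_mod_cast h
  simp only [map_add, hi] at h1
  linarith

lemma integrable_sub (μ : Measure (HeightFunction d)) [IsFiniteMeasure μ] (hd : 1 ≤ d)
    (x : Vertex d) : Integrable (fun f : HeightFunction d => ((f x - f 0 : ℤ) : ℝ)) μ := by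
  obtain ⟨n, hn⟩ : ∃ n : ℕ, x ∈ box d n := by
    refine ⟨∑ i, (coord d x i).natAbs + 1, mem_box.mpr fun i => ?_⟩
    have := Finset.single_le_sum (f := fun i => (coord d x i).natAbs) (fun _ _ => Nat.zero_le _)
      (Finset.mem_univ i)
    push_cast [Int.natCast_natAbs] at this ⊢
    zify at this
    have h1 := le_abs_self (coord d x i)
    have h2 := neg_abs_le (coord d x i)
    constructor <;> linarith
  refine Integrable.of_bound ((measurable_from_top (f := fun k : ℤ => (k : ℝ))).comp
    (measurable_sub x 0)).aestronglyMeasurable (d * (d * n : ℕ)) (Eventually.of_forall fun f => ?_)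
  rw [Real.norm_eq_abs, ← Int.cast_abs]
  exact_mod_cast f.abs_sub_zero_le hd hn

/-- A step is at most 1 and has mean 1, so it equals 1 almost surely; there are countably many
vertices. -/
lemma ae_step_eq_one (hd : 1 ≤ d) {μ : Measure (HeightFunction d)} [IsProbabilityMeasure μ]
    {s : Slope d} (hμ : HasSlope μ s) {i : Fin (d + 1)} (hi : s (embed d (gen i)) = 1) :
    ∀ᵐ f ∂μ, ∀ x, f (x + gen i) - f x = 1 := by
  rw [ae_all_iff]
  intro x
  have hsub : Integrable (fun f : HeightFunction d =>
      ((f (x + gen i) - f 0 : ℤ) : ℝ) - ((f x - f 0 : ℤ) : ℝ)) μ :=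
    (integrable_sub μ hd _).sub (integrable_sub μ hd _)
  have hinteg : Integrable (fun f : HeightFunction d =>
      (1 : ℝ) - (((f (x + gen i) - f 0 : ℤ) : ℝ) - ((f x - f 0 : ℤ) : ℝ))) μ :=
    (integrable_const _).sub hsub
  have hzero : ∫ f, ((1 : ℝ) - (((f (x + gen i) - f 0 : ℤ) : ℝ) - ((f x - f 0 : ℤ) : ℝ))) ∂μ
      = 0 := by
    rw [integral_sub (integrable_const _) hsub,
      integral_sub (integrable_sub μ hd _) (integrable_sub μ hd _), ← hμ, ← hμ, map_add, map_add,
      hi]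
    simp
  rw [integral_eq_zero_iff_of_nonneg (fun f => ?_) hinteg] at hzero
  · filter_upwards [hzero] with f hf
    have h : (1 : ℝ) - (((f (x + gen i) - f 0 : ℤ) : ℝ) - ((f x - f 0 : ℤ) : ℝ)) = 0 := hf
    have h' : ((f (x + gen i) - f x : ℤ) : ℝ) = (1 : ℤ) := by push_cast at h ⊢; linarith
    exact_mod_cast h'
  · have h : f (x + gen i) - f x ≤ 1 := by rcases f.grad x i with h | h <;> omega
    have h' : ((f (x + gen i) - f x : ℤ) : ℝ) ≤ (1 : ℤ) := by exact_mod_cast h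
    push_cast at h' ⊢
    simp only [Pi.zero_apply]
    linarith

lemma meanLog_eq_zero (hd : 1 ≤ d) {μ : Measure (HeightFunction d)} [IsProbabilityMeasure μ]
    {s : Slope d} (hμ : HasSlope μ s) {i : Fin (d + 1)} (hi : s (embed d (gen i)) = 1) (n : ℕ) :
    meanLog μ n = 0 := by
  refine integral_eq_zero_of_ae ?_
  filter_upwards [ae_step_eq_one hd hμ hi] with f hf
  rw [numMod_eq_one hd _ f i hf]
  simp

/-! ### Equality of specific entropy and surface tension -/

theorem exists_tendsto_tensionSeq_and_entropy (hd : 1 ≤ d) {s : Slope d} (hs : s ∈ lipSlopes d)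
    {μ : Measure (HeightFunction d)} (hμ : IsConcentratedGibbs μ s) :
    ∃ σ, Tendsto (tensionSeq s hs) atTop (𝓝 σ) ∧
      Tendsto (fun n : ℕ => 1 / ((box d n).card : ℝ) * entropyIn (box d n) μ) atTop (𝓝 σ) := by
  have := hμ.isProb
  obtain ⟨t, ht⟩ := exists_tendsto_meanLog hd hμ.shiftInvariant
  refine ⟨-t, ?_, tendsto_entropyIn hd hμ.gibbs ht⟩
  simp only [funext (tensionSeq_eq hd hs)]
  refine Tendsto.neg ?_
  by_cases hex : ∃ i, s (embed d (gen i)) = 1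
  · obtain ⟨i, hi⟩ := hex
    refine ht.congr fun n => ?_
    rw [meanLog_eq_zero hd hμ.slope hi, numMod_eq_one hd _ _ i (slopeFloor_step hs hi)]
    simp
  · push Not at hex
    obtain ⟨j, -, hj⟩ := Finset.exists_max_image Finset.univ
      (fun i : Fin (d + 1) => s (embed d (gen i))) Finset.univ_nonempty
    -- The slack is the least of the numbers `1 - s(𝐠ᵢ)`, positive because there are finitely many
    -- directions.
    have hη0 : 0 < 1 - s (embed d (gen j)) := sub_pos.mpr ((hs j).lt_of_ne (hex j))
    have hη : ∀ i, s (embed d (gen i)) + (1 - s (embed d (gen j))) ≤ 1 := fun i => by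
      linarith [hj i (Finset.mem_univ i)]
    exact tendsto_order.mpr ⟨fun a ha => eventually_lt_log_numMod hd hμ hs hη0 hη ht ha,
      fun b hb => eventually_log_numMod_lt hd hμ hs hη0 hη ht hb⟩

end Stepped

end

theorem mainTheorem8 (d : ℕ) (hd : 2 ≤ d) (s : Stepped.Slope d) (hs : s ∈ Stepped.lipSlopes d)
    (μ : Measure (Stepped.HeightFunction d)) (hμ : Stepped.IsConcentratedGibbs μ s) :
    Tendsto (Stepped.tensionSeq s hs) atTop (𝓝 (Stepped.surfaceTension s hs)) ∧
      Stepped.specificEntropy μ = Stepped.surfaceTension s hs := by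
  obtain ⟨σ, h₁, h₂⟩ :=
    Stepped.exists_tendsto_tensionSeq_and_entropy (one_le_two.trans hd) hs hμ
  have hσ : Stepped.surfaceTension s hs = σ := h₁.limUnder_eq
  rw [hσ, Stepped.specificEntropy, if_pos ⟨σ, h₂⟩]
  exact ⟨h₁, h₂.limUnder_eq⟩
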